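/- **Types and domains.** Pure types are the closed expressions of the grammar $\tau ::= 1 \mid \tau\times\tau \mid \tau\to\tau \mid \tau+\tau \mid \alpha \mid \mathrm{rec}\,\alpha.\tau$. They are interpreted as Scott domains: $[\![1]\!]=\{\bot<\top\}$; products are Cartesian products; $[\![\sigma\to\tau]\!]$ is the set of Scott-continuous functions with the pointwise order; $[\![\sigma+\tau]\!]=([\![\sigma]\!]\amalg[\![\tau]\!])_\bot$ is the disjoint union with a new least element; $[\![\mathrm{rec}\,\alpha.\tau]\!]$ is the canonical (bilimit) solution of its domain equation, with isomorphism $\mathrm{unfold}:[\![\mathrm{rec}\,\alpha.\tau]\!]\cong[\![\tau[\mathrm{rec}\,\alpha.\tau/\alpha]]\!]$. **Formulae.** Iteration terms are $t ::= k\mid 0\mid t+1$ with $k$ an iteration variable. For a context $\mathcal E$ of typed fixpoint variables, formulae of type $\tau$ over $\mathcal E$ are built from $\top$, $\bot$, $\varphi\wedge\psi$, $\varphi\vee\psi$; $\langle\langle\rangle\rangle$ (at type $1$); $\langle\pi_i\rangle\varphi$ at $\tau_1\times\tau_2$ and $\langle\mathrm{in}_i\rangle\varphi$ at $\tau_1+\tau_2$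 for $\varphi$ of type $\tau_i$; $\langle\mathrm{fold}\rangle\varphi$ at $\mathrm{rec}\,\alpha.\tau$ for $\varphi$ of type $\tau[\mathrm{rec}\,\alpha.\tau/\alpha]$; the variables $X:\tau$ of $\mathcal E$; the bounded iterations $(\mu^tX)\varphi$, $(\nu^tX)\varphi$ for $\varphi$ of type $\tau$ over $\mathcal E,X:\tau$; $(\exists k)\varphi$, $(\forall k)\varphi$; and $\psi\Vdash\varphi$ of type $\sigma\to\tau$ for $\psi$, $\varphi$ of types $\sigma$, $\tau$ over the empty context. The languages $L^{s}(\mathcal E;\tau)$, for the polarities $s\in\{\pm,+,-\}$, are closed under all these formers, with the following restrictions: $(\exists k)\varphi\in L^{s}$ only if $s=+$, $\varphi\in L^+$ and $k\,\mathrm{Pos}\,\varphi$; $(\forall k)\varphi\in L^{s}$ only if $s=-$, $\varphi\in L^-$ and $k\,\mathrm{Neg}\,\varphi$; $(\psi\Vdash\varphi)\in L^s$ iff $\psi\in L^{-s}$ and $\varphi\in L^s$ (where $-\pm=\pm$). Here $\mathrm{Pos}$ and $\mathrm{Neg}$ are the least predicates such that: $k\,\mathrm{Pos}\,\varphi$ and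 $k\,\mathrm{Neg}\,\varphi$ hold if $k\notin FV(\varphi)$; both are preserved by $\wedge$, $\vee$ and the modalities; $\mathrm{Pos}$ is preserved by $(\exists l)$ and $(\mu^tX)$, and by $(\nu^tX)$ if $k\notin FV(t)$; $\mathrm{Neg}$ is preserved by $(\forall l)$ and $(\nu^tX)$, and by $(\mu^tX)$ if $k\notin FV(t)$; $k\,\mathrm{Pos}\,(\psi\Vdash\varphi)$ if $k\,\mathrm{Neg}\,\psi$ and $k\,\mathrm{Pos}\,\varphi$; and dually for $\mathrm{Neg}$. The set $L^\wedge(\tau)$ of *conjunctive* formulae consists of the formulae over the empty context built from $\top,\bot,\wedge$, $\langle\langle\rangle\rangle$, the modalities and $\Vdash$ only. **Semantics.** A formula of type $\tau$ denotes a subset of $[\![\tau]\!]$ under a valuation: $\top,\bot,\wedge,\vee$ are $[\![\tau]\!],\emptyset,\cap,\cup$; $[\![\langle\langle\rangle\rangle]\!]=\{\top\}$; $[\![\langle\pi_i\rangle\varphi]\!]=\{x\mid\pi_i(x)\in[\![\varphi]\!]\}$; $[\![\langle\mathrm{in}_i\rangle\varphi]\!]=\{\mathrm{in}_i(x)\mid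 x\in[\![\varphi]\!]\}$; $[\![\langle\mathrm{fold}\rangle\varphi]\!]=\{x\mid\mathrm{unfold}(x)\in[\![\varphi]\!]\}$; $[\![\psi\Vdash\varphi]\!]=\{f\mid\forall x\in[\![\psi]\!],\ f(x)\in[\![\varphi]\!]\}$; $(\mu^tX)\varphi$ and $(\nu^tX)\varphi$ are the $t$-fold iterates of $S\mapsto[\![\varphi]\!][S/X]$ on $\emptyset$ and on the whole domain; $(\exists k),(\forall k)$ are $\bigcup_{n\in\mathbb N}$ and $\bigcap_{n\in\mathbb N}$. **Deduction.** A sequent is a pair $\psi\vdash\varphi$ with $\psi,\varphi\in L^s(\mathcal E;\tau)$ for some polarity $s$. Derivable sequents and the predicate $C$ on conjunctive formulae are defined by simultaneous induction. In the rules below, which are read as restricted to sequents, "$A\Rightarrow B$" means "from $A$ infer $B$", and $\Delta$ ranges over $\pi_1,\pi_2,\mathrm{in}_1,\mathrm{in}_2,\mathrm{fold}$. * Propositional: $\varphi\vdash\varphi$; $\psi\vdash\theta,\ \theta\vdash\varphi\Rightarrow\psi\vdash\varphi$; $\psi\wedge(\varphi\vee\theta)\vdash(\psi\wedge\varphi)\vee(\psi\wedge\theta)$;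 $\psi\vdash\varphi_1,\ \psi\vdash\varphi_2\Rightarrow\psi\vdash\varphi_1\wedge\varphi_2$; $\psi_i\vdash\varphi\Rightarrow\psi_1\wedge\psi_2\vdash\varphi$ ($i=1,2$); $\psi\vdash\top$; $\psi\vdash\varphi_i\Rightarrow\psi\vdash\varphi_1\vee\varphi_2$ ($i=1,2$); $\psi_1\vdash\varphi,\ \psi_2\vdash\varphi\Rightarrow\psi_1\vee\psi_2\vdash\varphi$; $\bot\vdash\varphi$. * Modal: $\langle\mathrm{in}_1\rangle\varphi\wedge\langle\mathrm{in}_2\rangle\psi\vdash\bot$; $\psi\vdash\varphi\Rightarrow\langle\Delta\rangle\psi\vdash\langle\Delta\rangle\varphi$; $\psi'\vdash\psi,\ \varphi\vdash\varphi'\Rightarrow(\psi\Vdash\varphi)\vdash(\psi'\Vdash\varphi')$; $\langle\Delta\rangle\varphi_1\wedge\langle\Delta\rangle\varphi_2\vdash\langle\Delta\rangle(\varphi_1\wedge\varphi_2)$; $\top\vdash\langle\Delta\rangle\top$ for $\Delta\ne\mathrm{in}_i$; $(\forall k)\langle\Delta\rangle\varphi\vdash\langle\Delta\rangle(\forall k)\varphi$;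 $\langle\Delta\rangle(\varphi_1\vee\varphi_2)\vdash\langle\Delta\rangle\varphi_1\vee\langle\Delta\rangle\varphi_2$; $\langle\Delta\rangle\bot\vdash\bot$; $\langle\Delta\rangle(\exists k)\varphi\vdash(\exists k)\langle\Delta\rangle\varphi$. * Quantifiers: $\psi\vdash\varphi[t/k]\Rightarrow\psi\vdash(\exists k)\varphi$; $\theta\wedge\varphi\vdash\psi\Rightarrow\theta\wedge(\exists k)\varphi\vdash\psi$ if $k\notin FV(\psi,\theta)$; $(\exists k)(\exists l)\varphi\vdash(\exists k)\varphi[k/l]$; $\varphi[t/k]\vdash\psi\Rightarrow(\forall k)\varphi\vdash\psi$; $\psi\vdash\varphi\vee\theta\Rightarrow\psi\vdash(\forall k)\varphi\vee\theta$ if $k\notin FV(\psi,\theta)$; $(\forall k)\varphi[k/l]\vdash(\forall k)(\forall l)\varphi$; and, for $\eta\in\{\mu,\nu\}$ and $k\notin FV(t)$: $(\eta^tX)(\exists k)\varphi\vdash(\exists k)(\eta^tX)\varphi$ and $(\forall k)(\eta^tX)\varphi\vdash(\eta^tX)(\forall k)\varphi$. * Bounded iteration: $(\mu^0X)\varphi\vdash\bot$;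 $(\mu^tX)\varphi\vdash\psi\Rightarrow(\mu^{t+1}X)\varphi\vdash\varphi[\psi/X]$; $\varphi[(\mu^tX)\varphi/X]\vdash(\mu^{t+1}X)\varphi$; $\top\vdash(\nu^0X)\varphi$; $\psi\vdash(\nu^tX)\varphi\Rightarrow\varphi[\psi/X]\vdash(\nu^{t+1}X)\varphi$; $(\nu^{t+1}X)\varphi\vdash\varphi[(\nu^tX)\varphi/X]$; $\psi\vdash\varphi\Rightarrow(\eta^tX)\psi\vdash(\eta^tX)\varphi$ for $\eta\in\{\mu,\nu\}$. * Implication: $((\forall k)\psi\Vdash\varphi)\vdash(\exists k)(\psi\Vdash\varphi)$ if $k\notin FV(\varphi)$; $(\psi\Vdash(\exists k)\varphi)\vdash(\exists k)(\psi\Vdash\varphi)$ if $\psi\in L^\pm$ and $k\notin FV(\psi)$; $(\forall k)(\psi\Vdash\varphi)\vdash((\exists k)\psi\Vdash\varphi)$ if $k\notin FV(\varphi)$; $(\forall k)(\psi\Vdash\varphi)\vdash(\psi\Vdash(\forall k)\varphi)$ if $k\notin FV(\psi)$; $(\psi\Vdash\varphi_1)\wedge(\psi\Vdash\varphi_2)\vdash(\psi\Vdash\varphi_1\wedge\varphi_2)$;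 $\top\vdash(\psi\Vdash\top)$; $(\psi_1\Vdash\varphi)\wedge(\psi_2\Vdash\varphi)\vdash(\psi_1\vee\psi_2\Vdash\varphi)$; $\top\vdash(\bot\Vdash\varphi)$; and, for conjunctive $\delta$: $(\delta\Vdash\varphi_1\vee\varphi_2)\vdash(\delta\Vdash\varphi_1)\vee(\delta\Vdash\varphi_2)$, and $C(\delta)\Rightarrow(\delta\Vdash\bot)\vdash\bot$. * Consistency: $C(\top)$; $C(\langle\langle\rangle\rangle)$; $C(\varphi)\Rightarrow C(\langle\mathrm{fold}\rangle\varphi)$ and $C(\varphi)\Rightarrow C(\langle\mathrm{in}_i\rangle\varphi)$; $C(\varphi),\ C(\psi)\Rightarrow C(\langle\pi_1\rangle\varphi\wedge\langle\pi_2\rangle\psi)$; $C(\psi),\ \psi\vdash\varphi\Rightarrow C(\varphi)$ for $\varphi$ conjunctive; and, for a finite family $(\psi_i,\varphi_i)_{i\in I}$: if $C(\psi_i)$ and $C(\varphi_i)$ for all $i\in I$, and for every $J\subseteq I$ either $\bigwedge_{j\in J}\psi_j\vdash\bot$ is derivable or $C(\bigwedge_{j\in J}\varphi_j)$, then $C(\bigwedge_{i\in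 I}(\psi_i\Vdash\varphi_i))$ (the empty conjunction being $\top$). **Theorem (Completeness of $L^\wedge$).** Let $\tau$ be a pure type and let $\varphi,\psi\in L^\wedge(\tau)$. 1. If $[\![\varphi]\!]\neq\emptyset$, then $C(\varphi)$ is derivable. 2. If $[\![\psi]\!]\subseteq[\![\varphi]\!]$, then $\psi\vdash\varphi$ is derivable. -/

import Mathlib

noncomputable section
namespace PosLog

/-- Pure type expressions with (at most) `m` free type variables, as de Bruijn indices;
`recty τ` is the recursive type `rec α. τ`. -/
inductive TyExpr : ℕ → Type
  | var {m : ℕ} : Fin m → TyExpr m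
  | unit {m : ℕ} : TyExpr m
  | prod {m : ℕ} : TyExpr m → TyExpr m → TyExpr m
  | arr {m : ℕ} : TyExpr m → TyExpr m → TyExpr m
  | sum {m : ℕ} : TyExpr m → TyExpr m → TyExpr m
  | recty {m : ℕ} : TyExpr (m + 1) → TyExpr m

namespace TyExpr

/-- Renaming of type variables. -/
def rename : {m k : ℕ} → (Fin m → Fin k) → TyExpr m → TyExpr k
  | _, _, r, var i => var (r i)
  | _, _, _, unit => unit
  | _, _, r, prod σ τ => prod (rename r σ) (rename r τ)
  | _, _, r, arr σ τ => arr (rename r σ) (rename r τ)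
  | _, _, r, sum σ τ => sum (rename r σ) (rename r τ)
  | _, _, r, recty τ => recty (rename (Fin.cases 0 fun i => (r i).succ) τ)

/-- Capture-avoiding simultaneous substitution. -/
def subst : {m k : ℕ} → (Fin m → TyExpr k) → TyExpr m → TyExpr k
  | _, _, s, var i => s i
  | _, _, _, unit => unit
  | _, _, s, prod σ τ => prod (subst s σ) (subst s τ)
  | _, _, s, arr σ τ => arr (subst s σ) (subst s τ)
  | _, _, s, sum σ τ => sum (subst s σ) (subst s τ)
  | _, _, s, recty τ => recty (subst (Fin.cases (var 0) fun i => (s i).rename Fin.succ) τ)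

/-- The unfolding `τ[rec α. τ / α]`. -/
def unfolding {m : ℕ} (τ : TyExpr (m + 1)) : TyExpr m :=
  τ.subst (Fin.cases (recty τ) var)

end TyExpr

/-- Pure types: the closed type expressions. -/
abbrev Ty : Type := TyExpr 0

/-- Finite partial orders with a least element. -/
structure FinPo where
  carrier : Type
  [po : PartialOrder carrier]
  [bot : OrderBot carrier]
  [fin : Finite carrier]

instance : CoeSort FinPo Type := ⟨FinPo.carrier⟩
instance (P : FinPo) : PartialOrder P := P.po
instance (P : FinPo) : OrderBot P := P.bot
instance (P : FinPo) : Finite P := P.fin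

instance finiteOrderHom (P Q : FinPo) : Finite (P →o Q) := DFunLike.finite _
instance finiteWithBotSum (P Q : FinPo) : Finite (WithBot (P ⊕ Q)) :=
  inferInstanceAs (Finite (Option (P ⊕ Q)))

/-- The `n`-th finite approximation of a pure type: its semantics cut off at constructor depth `n`,
starting from the one-point domain at depth `0`.  All approximations are finite, so that the
monotone maps between them are exactly the Scott-continuous ones.  (Free type variables, which do
not occur in pure types, are interpreted by the one-point domain.) -/
def approx {m : ℕ} : ℕ → TyExpr m → FinPo
  | 0, _ => ⟨PUnit⟩
  | _ + 1, .var _ => ⟨PUnit⟩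
  | _ + 1, .unit => ⟨Bool⟩
  | n + 1, .prod σ τ => ⟨approx n σ × approx n τ⟩
  | n + 1, .arr σ τ => ⟨approx n σ →o approx n τ⟩
  | n + 1, .sum σ τ => ⟨WithBot (approx n σ ⊕ approx n τ)⟩
  | n + 1, .recty τ => approx n τ.unfolding

/-- The action of the lifted sum `(A ⨿ B)_⊥` on monotone maps. -/
def liftSum {A B A' B' : Type} [PartialOrder A] [PartialOrder B] [PartialOrder A']
    [PartialOrder B'] (f : A →o A') (g : B →o B') : WithBot (A ⊕ B) →o WithBot (A' ⊕ B') where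
  toFun := WithBot.map (Sum.map f g)
  monotone' := Monotone.withBot_map fun a b h => by
    cases h with
    | inl h => exact Sum.LiftRel.inl (f.monotone h)
    | inr h => exact Sum.LiftRel.inr (g.monotone h)

/-- The action of the function space on monotone maps, contravariant in the first argument. -/
def arrMap {A B A' B' : Type} [PartialOrder A] [PartialOrder B] [PartialOrder A']
    [PartialOrder B'] (f : A' →o A) (g : B →o B') : (A →o B) →o (A' →o B') where
  toFun h := g.comp (h.comp f)
  monotone' _ _ hh a := g.monotone (hh (f a))

mutual
/-- The canonical map from the `n`-th to the `k`-th approximation: the projection of an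
embedding-projection pair if `k ≤ n`, its embedding if `n ≤ k`. -/
def tr {m : ℕ} : (n k : ℕ) → (τ : TyExpr m) → approx n τ →o approx k τ
  | 0, _, _ => OrderHom.const _ ⊥
  | _ + 1, 0, _ => OrderHom.const _ ⊥
  | _ + 1, _ + 1, .var _ => OrderHom.id
  | _ + 1, _ + 1, .unit => OrderHom.id
  | n + 1, k + 1, .prod σ τ => OrderHom.prodMap (tr n k σ) (tr n k τ)
  | n + 1, k + 1, .arr σ τ => arrMap (rt n k σ) (tr n k τ)
  | n + 1, k + 1, .sum σ τ => liftSum (tr n k σ) (tr n k τ)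
  | n + 1, k + 1, .recty τ => tr n k τ.unfolding
termination_by structural n => n
/-- The canonical map from the `k`-th to the `n`-th approximation (equal to `tr k n`, see
`rt_eq_tr`); a separate function only because `tr` swaps its arguments at function types. -/
def rt {m : ℕ} : (n k : ℕ) → (τ : TyExpr m) → approx k τ →o approx n τ
  | 0, _, _ => OrderHom.const _ ⊥
  | _ + 1, 0, _ => OrderHom.const _ ⊥
  | _ + 1, _ + 1, .var _ => OrderHom.id
  | _ + 1, _ + 1, .unit => OrderHom.id
  | n + 1, k + 1, .prod σ τ => OrderHom.prodMap (rt n k σ) (rt n k τ)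
  | n + 1, k + 1, .arr σ τ => arrMap (tr n k σ) (rt n k τ)
  | n + 1, k + 1, .sum σ τ => liftSum (rt n k σ) (rt n k τ)
  | n + 1, k + 1, .recty τ => rt n k τ.unfolding
termination_by structural n => n
end


theorem rt_eq_tr_aux {m : ℕ} (n : ℕ) :
    ∀ (k : ℕ) (τ : TyExpr m), rt n k τ = tr k n τ ∧ rt k n τ = tr n k τ := by
  induction n with
  | zero => intro k τ; cases k <;> exact ⟨rfl, rfl⟩
  | succ n ih =>
    intro k τ
    cases k with
    | zero => exact ⟨rfl, rfl⟩
    | succ k =>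
      cases τ with
      | var i => exact ⟨rfl, rfl⟩
      | unit => exact ⟨rfl, rfl⟩
      | prod σ τ =>
        simp only [rt, tr, (ih k σ).1, (ih k τ).1, (ih k σ).2, (ih k τ).2]; exact ⟨rfl, rfl⟩
      | arr σ τ =>
        simp only [rt, tr, (ih k σ).1, (ih k τ).1, (ih k σ).2, (ih k τ).2]; exact ⟨rfl, rfl⟩
      | sum σ τ =>
        simp only [rt, tr, (ih k σ).1, (ih k τ).1, (ih k σ).2, (ih k τ).2]; exact ⟨rfl, rfl⟩
      | recty τ => exact ih k τ.unfolding

theorem rt_eq_tr {m : ℕ} (n k : ℕ) (τ : TyExpr m) : rt n k τ = tr k n τ :=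
  (rt_eq_tr_aux n k τ).1

theorem tr_zero_left {m : ℕ} (k : ℕ) (τ : TyExpr m) (a : approx 0 τ) : tr 0 k τ a = ⊥ := rfl

theorem tr_zero_right {m : ℕ} (n : ℕ) (τ : TyExpr m) (a : approx n τ) : tr n 0 τ a = ⊥ := by
  cases n <;> rfl

/-- Application of an approximation at an arrow type. -/
def apx {m n : ℕ} {σ τ : TyExpr m} (h : approx (n + 1) (.arr σ τ)) (a : approx n σ) :
    approx n τ :=
  OrderHom.toFun (α := approx n σ) (β := approx n τ) h a

theorem apx_ext {m n : ℕ} {σ τ : TyExpr m} {f g : approx (n + 1) (.arr σ τ)}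
    (h : ∀ a, apx f a = apx g a) : f = g :=
  OrderHom.ext (α := approx n σ) (β := approx n τ) f g (funext h)

theorem apx_mono {m n : ℕ} {σ τ : TyExpr m} {f g : approx (n + 1) (.arr σ τ)}
    {a b : approx n σ} (h : f ≤ g) (hab : a ≤ b) : apx f a ≤ apx g b :=
  (OrderHom.monotone' (α := approx n σ) (β := approx n τ) f hab).trans (h b)

theorem apx_tr {m : ℕ} (n k : ℕ) (σ τ : TyExpr m) (h : approx (n + 1) (.arr σ τ))
    (a : approx k σ) :
    apx (tr (n + 1) (k + 1) (.arr σ τ) h) a = tr n k τ (apx h (tr k n σ a)) := by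
  change tr n k τ (apx h (rt n k σ a)) = _
  rw [rt_eq_tr]

/-- Left injection at the level of approximations. -/
def inlx {m n : ℕ} {σ : TyExpr m} (τ : TyExpr m) (a : approx n σ) : approx (n + 1) (.sum σ τ) :=
  WithBot.some (α := approx n σ ⊕ approx n τ) (Sum.inl a)

/-- Right injection at the level of approximations. -/
def inrx {m n : ℕ} (σ : TyExpr m) {τ : TyExpr m} (a : approx n τ) : approx (n + 1) (.sum σ τ) :=
  WithBot.some (α := approx n σ ⊕ approx n τ) (Sum.inr a)

theorem sumx_cases {m n : ℕ} {σ τ : TyExpr m} (x : approx (n + 1) (.sum σ τ)) :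
    x = ⊥ ∨ (∃ a, x = inlx τ a) ∨ ∃ b, x = inrx σ b := by
  rcases (show WithBot (approx n σ ⊕ approx n τ) from x) with _ | a | b
  · exact Or.inl rfl
  · exact Or.inr (Or.inl ⟨a, rfl⟩)
  · exact Or.inr (Or.inr ⟨b, rfl⟩)

theorem tr_inlx {m : ℕ} (n k : ℕ) (σ τ : TyExpr m) (a : approx n σ) :
    tr (n + 1) (k + 1) (.sum σ τ) (inlx τ a) = inlx τ (tr n k σ a) := rfl

theorem tr_inrx {m : ℕ} (n k : ℕ) (σ τ : TyExpr m) (a : approx n τ) :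
    tr (n + 1) (k + 1) (.sum σ τ) (inrx σ a) = inrx σ (tr n k τ a) := rfl

theorem inlx_le {m n : ℕ} {σ τ : TyExpr m} {a b : approx n σ} :
    inlx τ a ≤ inlx τ b ↔ a ≤ b :=
  WithBot.coe_le_coe.trans Sum.inl_le_inl_iff

theorem inrx_le {m n : ℕ} {σ τ : TyExpr m} {a b : approx n τ} :
    inrx σ a ≤ inrx σ b ↔ a ≤ b :=
  WithBot.coe_le_coe.trans Sum.inr_le_inr_iff

theorem tr_bot {m : ℕ} (n : ℕ) : ∀ (k : ℕ) (τ : TyExpr m), tr n k τ ⊥ = ⊥ := by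
  induction n with
  | zero => intro k τ; rfl
  | succ n ih =>
    intro k τ
    cases k with
    | zero => rfl
    | succ k =>
      cases τ with
      | var i => rfl
      | unit => rfl
      | prod σ τ => exact Prod.ext (ih k σ) (ih k τ)
      | arr σ τ =>
        refine apx_ext fun a => ?_
        rw [apx_tr]
        exact ih k τ
      | sum σ τ => rfl
      | recty τ => exact ih k τ.unfolding

theorem tr_tr_aux {m : ℕ} (l : ℕ) : ∀ (n k : ℕ) (τ : TyExpr m) (a : approx n τ),
    (n ≤ l ∨ k ≤ l → tr l k τ (tr n l τ a) = tr n k τ a) ∧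
      tr l k τ (tr n l τ a) ≤ tr n k τ a := by
  induction l with
  | zero =>
    intro n k τ a
    rw [tr_zero_right, tr_bot]
    refine ⟨?_, bot_le⟩
    rintro (h | h)
    · obtain rfl := Nat.le_zero.1 h; rfl
    · obtain rfl := Nat.le_zero.1 h; rw [tr_zero_right]
  | succ l ih =>
    intro n k τ a
    cases n with
    | zero => rw [tr_zero_left, tr_zero_left, tr_bot]; exact ⟨fun _ => rfl, le_rfl⟩
    | succ n =>
    cases k with
    | zero => rw [tr_zero_right, tr_zero_right]; exact ⟨fun _ => rfl, le_rfl⟩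
    | succ k =>
    simp only [Nat.succ_le_succ_iff]
    cases τ with
    | var i => exact ⟨fun _ => rfl, le_rfl⟩
    | unit => exact ⟨fun _ => rfl, le_rfl⟩
    | prod σ τ =>
      exact ⟨fun h => Prod.ext ((ih n k σ _).1 h) ((ih n k τ _).1 h),
        (ih n k σ _).2, (ih n k τ _).2⟩
    | arr σ τ =>
      constructor
      · intro h
        refine apx_ext fun b => ?_
        rw [apx_tr, apx_tr, apx_tr, (ih k n σ b).1 h.symm, (ih n k τ _).1 h]
      · intro b
        change apx _ b ≤ apx _ b
        rw [apx_tr, apx_tr, apx_tr]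
        exact ((ih n k τ _).2).trans
          ((tr n k τ).monotone (apx_mono le_rfl (ih k n σ b).2))
    | sum σ τ =>
      rcases sumx_cases a with rfl | ⟨a, rfl⟩ | ⟨a, rfl⟩
      · rw [tr_bot, tr_bot, tr_bot]; exact ⟨fun _ => rfl, le_rfl⟩
      · rw [tr_inlx, tr_inlx, tr_inlx]
        exact ⟨fun h => congrArg _ ((ih n k σ a).1 h), inlx_le.2 (ih n k σ a).2⟩
      · rw [tr_inrx, tr_inrx, tr_inrx]
        exact ⟨fun h => congrArg _ ((ih n k τ a).1 h), inrx_le.2 (ih n k τ a).2⟩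
    | recty τ => exact ih n k τ.unfolding a

theorem tr_tr {m : ℕ} {n l k : ℕ} (h : n ≤ l ∨ k ≤ l) (τ : TyExpr m) (a : approx n τ) :
    tr l k τ (tr n l τ a) = tr n k τ a := (tr_tr_aux l n k τ a).1 h

theorem tr_tr_le {m : ℕ} (n l k : ℕ) (τ : TyExpr m) (a : approx n τ) :
    tr l k τ (tr n l τ a) ≤ tr n k τ a := (tr_tr_aux l n k τ a).2

theorem tr_self {m : ℕ} (n : ℕ) : ∀ (τ : TyExpr m) (a : approx n τ), tr n n τ a = a := by
  induction n with
  | zero => intro τ a; rfl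
  | succ n ih =>
    intro τ a
    cases τ with
    | var i => rfl
    | unit => rfl
    | prod σ τ => exact Prod.ext (ih σ _) (ih τ _)
    | arr σ τ =>
      refine apx_ext fun b => ?_
      rw [apx_tr, ih σ, ih τ]
    | sum σ τ =>
      rcases sumx_cases a with rfl | ⟨a, rfl⟩ | ⟨a, rfl⟩
      · exact tr_bot _ _ _
      · rw [tr_inlx, ih]
      · rw [tr_inrx, ih]
    | recty τ => exact ih τ.unfolding a

/-- The limit of the finite approximations of `τ` along the projections, i.e. the colimit of the
`ω`-chain of their embeddings: compatible threads, ordered pointwise. -/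
structure Lim {m : ℕ} (τ : TyExpr m) : Type where
  val : ∀ n, approx n τ
  property : ∀ n k, k ≤ n → tr n k τ (val n) = val k

theorem Lim.val_injective {m : ℕ} {τ : TyExpr m} :
    Function.Injective (Lim.val : Lim τ → ∀ n, approx n τ) := by
  rintro ⟨x, hx⟩ ⟨y, hy⟩ h
  cases h
  rfl

instance {m : ℕ} (τ : TyExpr m) : PartialOrder (Lim τ) where
  le x y := ∀ n, x.val n ≤ y.val n
  le_refl x n := le_rfl
  le_trans x y z h h' n := (h n).trans (h' n)
  le_antisymm x y h h' := Lim.val_injective (funext fun n => le_antisymm (h n) (h' n))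

/-- Scott-continuous functions, ordered pointwise. -/
structure ScottMap (X Y : Type) [PartialOrder X] [PartialOrder Y] : Type where
  val : X → Y
  property : ScottContinuous val

theorem ScottMap.val_injective {X Y : Type} [PartialOrder X] [PartialOrder Y] :
    Function.Injective (ScottMap.val : ScottMap X Y → X → Y) := by
  rintro ⟨x, hx⟩ ⟨y, hy⟩ h
  cases h
  rfl

instance (X Y : Type) [PartialOrder X] [PartialOrder Y] : PartialOrder (ScottMap X Y) where
  le f g := ∀ x, f.val x ≤ g.val x
  le_refl f x := le_rfl
  le_trans f g h p q x := (p x).trans (q x)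
  le_antisymm f g p q := ScottMap.val_injective (funext fun x => le_antisymm (p x) (q x))

/-- The interpretation of pure types as Scott domains.  `Unit` is `{⊥ < ⊤}` (as `Bool`), products
are Cartesian products, arrow types are the spaces of Scott-continuous functions with the pointwise
order, sums are the weak coproducts `(X ⨿ Y)_⊥`, and recursive types are the canonical solutions of
the domain equations, obtained as bilimits of approximations that start from the one-point domain;
see `unfold` for the isomorphism with the unfolded type. -/
def den {m : ℕ} : TyExpr m → PartOrd.{0}
  | .var _ => PartOrd.of PUnit
  | .unit => PartOrd.of Bool
  | .prod σ τ => PartOrd.of (den σ × den τ)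
  | .arr σ τ => PartOrd.of (ScottMap (den σ) (den τ))
  | .sum σ τ => PartOrd.of (WithBot (den σ ⊕ den τ))
  | .recty τ => PartOrd.of (Lim (.recty τ))


namespace Lim

variable {m : ℕ} {σ τ : TyExpr m}

theorem le_iff {x y : Lim τ} : x ≤ y ↔ ∀ n, x.1 (n + 1) ≤ y.1 (n + 1) := by
  refine ⟨fun h n => h (n + 1), fun h n => ?_⟩
  cases n with
  | zero => exact le_of_eq rfl
  | succ n => exact h n

theorem ext {x y : Lim τ} (h : ∀ n, x.1 (n + 1) = y.1 (n + 1)) : x = y :=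
  le_antisymm (le_iff.2 fun n => (h n).le) (le_iff.2 fun n => (h n).ge)

/-- A thread from its components at positive levels. -/
def succMk (y : ∀ n, approx (n + 1) τ)
    (h : ∀ n k, k ≤ n → tr (n + 1) (k + 1) τ (y n) = y k) : Lim τ :=
  ⟨fun n => Nat.casesOn n ⊥ y, fun n k hk => by
    cases k with
    | zero => rfl
    | succ k =>
      cases n with
      | zero => exact absurd hk (by omega)
      | succ n => exact h n k (by omega)⟩

/-- The canonical embedding of the `n`-th approximation. -/
def emb (τ : TyExpr m) (n : ℕ) (a : approx n τ) : Lim τ :=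
  ⟨fun k => tr n k τ a, fun _ _ h => tr_tr (Or.inr h) τ a⟩

theorem emb_mono (n : ℕ) {a b : approx n τ} (h : a ≤ b) : emb τ n a ≤ emb τ n b :=
  fun k => (tr n k τ).monotone h

theorem emb_le (x : Lim τ) (n : ℕ) : emb τ n (x.1 n) ≤ x := by
  intro k
  rcases le_total k n with h | h
  · exact (x.2 n k h).le
  · change tr n k τ (x.1 n) ≤ x.1 k
    rw [← x.2 k n h]
    exact (tr_tr_le k n k τ _).trans (tr_self k τ _).le

theorem emb_le_emb (x : Lim τ) {n k : ℕ} (h : n ≤ k) :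
    emb τ n (x.1 n) ≤ emb τ k (x.1 k) := by
  intro l
  change tr n l τ (x.1 n) ≤ tr k l τ (x.1 k)
  rw [← x.2 k n h]
  exact tr_tr_le k n l τ _

theorem isLUB_emb (x : Lim τ) : IsLUB (Set.range fun n => emb τ n (x.1 n)) x := by
  refine ⟨?_, fun y hy n => ?_⟩
  · rintro _ ⟨n, rfl⟩
    exact emb_le x n
  · have := hy ⟨n, rfl⟩ n
    change tr n n τ (x.1 n) ≤ y.1 n at this
    rwa [tr_self] at this

theorem directed_emb (x : Lim τ) :
    DirectedOn (· ≤ ·) (Set.range fun n => emb τ n (x.1 n)) := by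
  rintro _ ⟨n, rfl⟩ _ ⟨k, rfl⟩
  exact ⟨_, ⟨max n k, rfl⟩, emb_le_emb x (le_max_left n k), emb_le_emb x (le_max_right n k)⟩

/-- Least upper bounds of directed sets are attained at every finite level. -/
theorem exists_eq_of_isLUB {d : Set (Lim τ)} (hn : d.Nonempty)
    (hd : DirectedOn (· ≤ ·) d) {x : Lim τ} (hx : IsLUB d x) (n : ℕ) :
    ∃ y ∈ d, y.1 n = x.1 n := by
  have hmax : ∀ n, ∃ y ∈ d, ∀ z ∈ d, z.1 n ≤ y.1 n := by
    intro n
    obtain ⟨a, ⟨y, hy, rfl⟩, ha⟩ :=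
      (Set.toFinite ((fun z : Lim τ => z.1 n) '' d)).exists_maximal (hn.image _)
    refine ⟨y, hy, fun z hz => ?_⟩
    obtain ⟨w, hw, hyw, hzw⟩ := hd y hy z hz
    exact (hzw n).trans (ha ⟨w, hw, rfl⟩ (hyw n))
  choose w hw hmw using hmax
  let u : Lim τ := ⟨fun n => (w n).1 n, fun n k hk => le_antisymm
    (((w n).2 n k hk).trans_le (hmw k _ (hw n)))
    (((w k).2 n k hk).symm.trans_le ((tr n k τ).monotone (hmw n _ (hw k))))⟩
  have hu : IsLUB d u := ⟨fun z hz n => hmw n z hz, fun y hy n => hy (hw n) n⟩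
  obtain rfl := hu.unique hx
  exact ⟨w n, hw n, rfl⟩

end Lim

section Iso

variable {m : ℕ}

/-- A free type variable. -/
def limVar (i : Fin m) : Lim (.var i : TyExpr m) ≃o PUnit.{1} where
  toFun _ := ⟨⟩
  invFun _ := Lim.succMk (fun _ => (⟨⟩ : PUnit)) fun _ _ _ => rfl
  left_inv _ := Lim.ext fun _ => rfl
  right_inv _ := rfl
  map_rel_iff' := ⟨fun _ => Lim.le_iff.2 fun _ => le_of_eq rfl, fun _ => le_rfl⟩

/-- The limit at the unit type. -/
def limUnit : Lim (.unit : TyExpr m) ≃o Bool where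
  toFun x := x.1 1
  invFun b := Lim.succMk (fun _ => b) fun _ _ _ => rfl
  left_inv x := Lim.ext fun n => (x.2 (n + 1) 1 (by omega)).symm
  right_inv _ := rfl
  map_rel_iff' {x y} := by
    refine ⟨fun h => Lim.le_iff.2 fun n => ?_, fun h => h 1⟩
    have hx : x.1 (n + 1) = x.1 1 := x.2 (n + 1) 1 (by omega)
    have hy : y.1 (n + 1) = y.1 1 := y.2 (n + 1) 1 (by omega)
    rw [hx, hy]
    exact h

/-- The limit at a product is the product of the limits. -/
def limProd (σ τ : TyExpr m) : Lim (.prod σ τ) ≃o Lim σ × Lim τ where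
  toFun x :=
    (⟨fun n => (show approx n σ × approx n τ from x.1 (n + 1)).1,
        fun n k h => congrArg Prod.fst (x.2 (n + 1) (k + 1) (by omega))⟩,
      ⟨fun n => (show approx n σ × approx n τ from x.1 (n + 1)).2,
        fun n k h => congrArg Prod.snd (x.2 (n + 1) (k + 1) (by omega))⟩)
  invFun p := Lim.succMk (fun n => (p.1.1 n, p.2.1 n)) fun n k h =>
    Prod.ext (p.1.2 n k h) (p.2.2 n k h)
  left_inv _ := Lim.ext fun _ => rfl
  right_inv _ := rfl
  map_rel_iff' := ⟨fun h => Lim.le_iff.2 fun n => ⟨h.1 n, h.2 n⟩,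
    fun h => ⟨fun n => (h (n + 1)).1, fun n => (h (n + 1)).2⟩⟩

/-- The limit at a recursive type is the limit at its unfolding: the approximations are shifted by one. -/
def limRec (τ : TyExpr (m + 1)) : Lim (.recty τ) ≃o Lim τ.unfolding where
  toFun x := ⟨fun n => x.1 (n + 1), fun n k h => x.2 (n + 1) (k + 1) (by omega)⟩
  invFun y := Lim.succMk y.1 fun n k h => y.2 n k h
  left_inv _ := Lim.ext fun _ => rfl
  right_inv _ := rfl
  map_rel_iff' := ⟨fun h => Lim.le_iff.2 h, fun h n => h (n + 1)⟩

/-- The threads of approximations at a sum type. -/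
def ofSum (σ τ : TyExpr m) : WithBot (Lim σ ⊕ Lim τ) → Lim (.sum σ τ)
  | none => Lim.succMk (fun _ => ⊥) fun _ _ _ => tr_bot _ _ _
  | some (Sum.inl x) => Lim.succMk (fun n => inlx τ (x.1 n)) fun n k h => by
      rw [tr_inlx, x.2 n k h]
  | some (Sum.inr x) => Lim.succMk (fun n => inrx σ (x.1 n)) fun n k h => by
      rw [tr_inrx, x.2 n k h]

theorem inlx_not_le_bot {n : ℕ} {σ τ : TyExpr m} (a : approx n σ) :
    ¬ (inlx τ a ≤ ⊥) := WithBot.not_coe_le_bot _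

theorem inrx_not_le_bot {n : ℕ} {σ τ : TyExpr m} (a : approx n τ) :
    ¬ (inrx σ a ≤ ⊥) := WithBot.not_coe_le_bot _

theorem not_inlx_le_inrx {n : ℕ} {σ τ : TyExpr m} (a : approx n σ) (b : approx n τ) :
    ¬ (inlx τ a ≤ inrx σ b) := fun h => Sum.not_inl_le_inr (WithBot.coe_le_coe.1 h)

theorem not_inrx_le_inlx {n : ℕ} {σ τ : TyExpr m} (a : approx n σ) (b : approx n τ) :
    ¬ (inrx σ b ≤ inlx τ a) := fun h => Sum.not_inr_le_inl (WithBot.coe_le_coe.1 h)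

theorem ofSum_le {σ τ : TyExpr m} (p q : WithBot (Lim σ ⊕ Lim τ)) :
    ofSum σ τ p ≤ ofSum σ τ q ↔ p ≤ q := by
  rcases p with _ | x | x
  · exact iff_of_true (Lim.le_iff.2 fun n => bot_le (α := approx (n + 1) (.sum σ τ))) bot_le
  · rcases q with _ | y | y
    · exact iff_of_false (fun h => inlx_not_le_bot _ (Lim.le_iff.1 h 0))
        (WithBot.not_coe_le_bot _)
    · refine Iff.trans ?_ (WithBot.coe_le_coe.trans Sum.inl_le_inl_iff).symm
      exact ⟨fun h n => inlx_le.1 (Lim.le_iff.1 h n), fun h => Lim.le_iff.2 fun n => inlx_le.2 (h n)⟩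
    · exact iff_of_false (fun h => not_inlx_le_inrx _ _ (Lim.le_iff.1 h 0))
        (fun h => Sum.not_inl_le_inr (WithBot.coe_le_coe.1 h))
  · rcases q with _ | y | y
    · exact iff_of_false (fun h => inrx_not_le_bot _ (Lim.le_iff.1 h 0))
        (WithBot.not_coe_le_bot _)
    · exact iff_of_false (fun h => not_inrx_le_inlx _ _ (Lim.le_iff.1 h 0))
        (fun h => Sum.not_inr_le_inl (WithBot.coe_le_coe.1 h))
    · refine Iff.trans ?_ (WithBot.coe_le_coe.trans Sum.inr_le_inr_iff).symm
      exact ⟨fun h n => inrx_le.1 (Lim.le_iff.1 h n), fun h => Lim.le_iff.2 fun n => inrx_le.2 (h n)⟩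

theorem inlx_inj {n : ℕ} {σ τ : TyExpr m} {a b : approx n σ} (h : inlx τ a = inlx τ b) : a = b :=
  le_antisymm (inlx_le.1 h.le) (inlx_le.1 h.ge)

theorem inrx_inj {n : ℕ} {σ τ : TyExpr m} {a b : approx n τ} (h : inrx σ a = inrx σ b) : a = b :=
  le_antisymm (inrx_le.1 h.le) (inrx_le.1 h.ge)

theorem ofSum_surjective (σ τ : TyExpr m) : Function.Surjective (ofSum σ τ) := by
  intro x
  have hx : ∀ n k, k ≤ n → tr (n + 1) (k + 1) _ (x.1 (n + 1)) = x.1 (k + 1) :=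
    fun n k h => x.2 (n + 1) (k + 1) (by omega)
  rcases sumx_cases (x.1 1) with h0 | ⟨a, h0⟩ | ⟨a, h0⟩
  · refine ⟨none, Lim.ext fun n => ?_⟩
    have := hx n 0 (Nat.zero_le n)
    rcases sumx_cases (x.1 (n + 1)) with h | ⟨b, h⟩ | ⟨b, h⟩
    · exact h.symm
    · rw [h, h0, tr_inlx] at this; exact absurd this.le (inlx_not_le_bot _)
    · rw [h, h0, tr_inrx] at this; exact absurd this.le (inrx_not_le_bot _)
  · have hall : ∀ n, ∃ b, x.1 (n + 1) = inlx τ b := by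
      intro n
      have := hx n 0 (Nat.zero_le n)
      rcases sumx_cases (x.1 (n + 1)) with h | h | ⟨b, h⟩
      · rw [h, h0, tr_bot] at this; exact absurd this.ge (inlx_not_le_bot _)
      · exact h
      · rw [h, h0, tr_inrx] at this; exact absurd this.le (not_inrx_le_inlx _ _)
    choose b hb using hall
    refine ⟨some (Sum.inl ⟨b, fun n k hk => ?_⟩), Lim.ext fun n => (hb n).symm⟩
    have := hx n k hk
    rw [hb, hb, tr_inlx] at this
    exact inlx_inj this
  · have hall : ∀ n, ∃ b, x.1 (n + 1) = inrx σ b := by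
      intro n
      have := hx n 0 (Nat.zero_le n)
      rcases sumx_cases (x.1 (n + 1)) with h | ⟨b, h⟩ | h
      · rw [h, h0, tr_bot] at this; exact absurd this.ge (inrx_not_le_bot _)
      · rw [h, h0, tr_inlx] at this; exact absurd this.le (not_inlx_le_inrx _ _)
      · exact h
    choose b hb using hall
    refine ⟨some (Sum.inr ⟨b, fun n k hk => ?_⟩), Lim.ext fun n => (hb n).symm⟩
    have := hx n k hk
    rw [hb, hb, tr_inrx] at this
    exact inrx_inj this

/-- The limit at a sum is the lifted sum of the limits. -/
def limSum (σ τ : TyExpr m) : Lim (.sum σ τ) ≃o WithBot (Lim σ ⊕ Lim τ) :=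
  (RelIso.ofSurjective (OrderEmbedding.ofMapLEIff (ofSum σ τ) ofSum_le)
    (ofSum_surjective σ τ)).symm

/-- The thread of finite approximations of a Scott-continuous function. -/
def ofScott (σ τ : TyExpr m) (g : ScottMap (Lim σ) (Lim τ)) : Lim (.arr σ τ) :=
  Lim.succMk (fun n => (⟨fun a => (g.1 (Lim.emb σ n a)).1 n,
      fun _ _ h => g.2.monotone (Lim.emb_mono n h) n⟩ : approx n σ →o approx n τ))
    fun n k h => apx_ext fun a => by
      refine (apx_tr n k σ τ _ a).trans ?_
      change tr n k τ ((g.1 (Lim.emb σ n (tr k n σ a))).1 n) = (g.1 (Lim.emb σ k a)).1 k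
      rw [(g.1 _).2 n k h]
      have : Lim.emb σ n (tr k n σ a) = Lim.emb σ k a :=
        Lim.val_injective (funext fun l => tr_tr (Or.inl h) σ a)
      rw [this]

theorem apx_ofScott {σ τ : TyExpr m} (g : ScottMap (Lim σ) (Lim τ)) (n : ℕ) (a : approx n σ) :
    apx ((ofScott σ τ g).1 (n + 1)) a = (g.1 (Lim.emb σ n a)).1 n := rfl

theorem ofScott_le {σ τ : TyExpr m} (g g' : ScottMap (Lim σ) (Lim τ)) :
    ofScott σ τ g ≤ ofScott σ τ g' ↔ g ≤ g' := by
  constructor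
  · intro h x
    have hlub := g.2 (Set.range_nonempty _) (Lim.directed_emb x) (Lim.isLUB_emb x)
    refine hlub.2 ?_
    rintro _ ⟨_, ⟨n, rfl⟩, rfl⟩ k
    let l := max n k
    have h1 : (g.1 (Lim.emb σ n (x.1 n))).1 l ≤ (g.1 (Lim.emb σ l (x.1 l))).1 l :=
      g.2.monotone (Lim.emb_le_emb x (le_max_left n k)) l
    have h2 : (g.1 (Lim.emb σ l (x.1 l))).1 l ≤ (g'.1 (Lim.emb σ l (x.1 l))).1 l :=
      Lim.le_iff.1 h l (x.1 l)
    have h3 : (g'.1 (Lim.emb σ l (x.1 l))).1 l ≤ (g'.1 x).1 l :=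
      g'.2.monotone (Lim.emb_le x l) l
    rw [← (g.1 _).2 l k (le_max_right n k), ← (g'.1 _).2 l k (le_max_right n k)]
    exact (tr l k τ).monotone (h1.trans (h2.trans h3))
  · exact fun h => Lim.le_iff.2 fun n a => h (Lim.emb σ n a) n

theorem ofScott_surjective (σ τ : TyExpr m) : Function.Surjective (ofScott σ τ) := by
  intro f
  let s : Lim σ → ℕ → ∀ n, approx n τ := fun x n k => tr n k τ (apx (f.1 (n + 1)) (x.1 n))
  have hs : ∀ x k, Monotone fun n => s x n k := fun x k => monotone_nat_of_le_succ fun n => by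
    change tr n k τ (apx (f.1 (n + 1)) (x.1 n)) ≤
      tr (n + 1) k τ (apx (f.1 (n + 1 + 1)) (x.1 (n + 1)))
    rw [← f.2 (n + 1 + 1) (n + 1) (by omega), apx_tr]
    refine (tr_tr_le _ _ _ _ _).trans ((tr (n + 1) k τ).monotone (apx_mono le_rfl ?_))
    rw [← x.2 (n + 1) n (by omega)]
    exact (tr_tr_le _ _ _ _ _).trans (tr_self _ _ _).le
  have hN : ∀ x k, ∃ N, ∀ n, N ≤ n → s x N k = s x n k := fun x k =>
    WellFoundedGT.monotone_chain_condition ⟨fun n => s x n k, hs x k⟩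
  choose N hN using hN
  have hle : ∀ x k n, s x n k ≤ s x (N x k) k := fun x k n => by
    rw [hN x k (max n (N x k)) (le_max_right _ _)]
    exact hs x k (le_max_left _ _)
  let g : Lim σ → Lim τ := fun x => ⟨fun k => s x (N x k) k, fun n k h => by
    rw [hN x n (max (N x n) (N x k)) (le_max_left _ _),
      hN x k (max (N x n) (N x k)) (le_max_right _ _)]
    exact tr_tr (Or.inr h) τ _⟩
  have hmono : Monotone g := fun x y h k =>
    ((tr _ k τ).monotone (apx_mono le_rfl (h _))).trans (hle y k (N x k))
  have hg : ScottContinuous g := by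
    intro d hn hd x hx
    refine ⟨?_, fun y hy k => ?_⟩
    · rintro _ ⟨z, hz, rfl⟩
      exact hmono (hx.1 hz)
    · obtain ⟨z, hz, hzx⟩ := Lim.exists_eq_of_isLUB hn hd hx (N x k)
      refine le_trans ?_ (hy ⟨z, hz, rfl⟩ k)
      change tr _ k τ (apx _ (x.1 (N x k))) ≤ _
      rw [← hzx]
      exact hle z k (N x k)
  refine ⟨⟨g, hg⟩, Lim.ext fun n => apx_ext fun a => ?_⟩
  refine (apx_ofScott _ n a).trans ?_
  change s (Lim.emb σ n a) (N _ n) n = _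
  rw [hN _ n (max (N (Lim.emb σ n a) n) n) (le_max_left _ _)]
  change tr _ n τ (apx (f.1 _) (tr n _ σ a)) = _
  rw [← apx_tr, f.2 _ _ (by omega)]

/-- The limit at an arrow type is the space of Scott-continuous functions between the limits. -/
def limArr (σ τ : TyExpr m) : Lim (.arr σ τ) ≃o ScottMap (Lim σ) (Lim τ) :=
  (RelIso.ofSurjective (OrderEmbedding.ofMapLEIff (ofScott σ τ) ofScott_le)
    (ofScott_surjective σ τ)).symm

end Iso

theorem orderIso_scottContinuous {X Y : Type} [PartialOrder X] [PartialOrder Y] (e : X ≃o Y) :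
    ScottContinuous e := fun _ _ _ _ h => e.isLUB_image'.2 h

/-- Order isomorphisms induce an order isomorphism of function spaces. -/
def scottCongr {X Y X' Y' : Type} [PartialOrder X] [PartialOrder Y] [PartialOrder X']
    [PartialOrder Y'] (e : X ≃o X') (e' : Y ≃o Y') : ScottMap X Y ≃o ScottMap X' Y' where
  toFun f := ⟨fun x => e' (f.1 (e.symm x)),
    ((orderIso_scottContinuous e.symm).comp f.2).comp (orderIso_scottContinuous e')⟩
  invFun f := ⟨fun x => e'.symm (f.1 (e x)),
    ((orderIso_scottContinuous e).comp f.2).comp (orderIso_scottContinuous e'.symm)⟩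
  left_inv f := ScottMap.val_injective (funext fun x => by simp)
  right_inv f := ScottMap.val_injective (funext fun x => by simp)
  map_rel_iff' {f g} := ⟨fun h x => by simpa using h (e x), fun h x => e'.monotone (h _)⟩

/-- Order isomorphisms induce an order isomorphism of products. -/
def prodCongr {X Y X' Y' : Type} [PartialOrder X] [PartialOrder Y] [PartialOrder X']
    [PartialOrder Y'] (e : X ≃o X') (e' : Y ≃o Y') : X × Y ≃o X' × Y' where
  toEquiv := e.toEquiv.prodCongr e'.toEquiv
  map_rel_iff' := and_congr e.le_iff_le e'.le_iff_le

/-- Every pure type is isomorphic to the limit of its finite approximations. -/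
def conv {m : ℕ} : (τ : TyExpr m) → Lim τ ≃o den τ
  | .var i => limVar i
  | .unit => limUnit
  | .prod σ τ => (limProd σ τ).trans (prodCongr (conv σ) (conv τ))
  | .arr σ τ => (limArr σ τ).trans (scottCongr (conv σ) (conv τ))
  | .sum σ τ => (limSum σ τ).trans (OrderIso.sumCongr (conv σ) (conv τ)).withBotCongr
  | .recty _ => OrderIso.refl _

/-- The isomorphism `⟦unfold⟧ : ⟦rec α. τ⟧ ≅ ⟦τ[rec α. τ / α]⟧`. -/
def unfold {m : ℕ} (τ : TyExpr (m + 1)) : den (.recty τ) ≃o den τ.unfolding :=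
  (limRec τ).trans (conv τ.unfolding)


/-! ### Formulae -/

/-- Iteration terms; iteration variables are de Bruijn indices, bound by the quantifiers. -/
inductive ITerm : Type
  | var : ℕ → ITerm
  | zero : ITerm
  | succ : ITerm → ITerm

namespace ITerm

def subst (s : ℕ → ITerm) : ITerm → ITerm
  | var k => s k
  | zero => zero
  | succ t => succ (subst s t)

def shift (t : ITerm) : ITerm := t.subst fun k => var (k + 1)

def eval (v : ℕ → ℕ) : ITerm → ℕ
  | var k => v k
  | zero => 0
  | succ t => eval v t + 1

/-- The iteration variable `k` occurs in the term. -/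
def Occurs (k : ℕ) : ITerm → Prop
  | var l => l = k
  | zero => False
  | succ t => Occurs k t

/-- The substitution `s` under one more binder. -/
def lift (s : ℕ → ITerm) : ℕ → ITerm
  | 0 => var 0
  | k + 1 => (s k).shift

/-- The substitution of `t` for the variable `0`. -/
def single (t : ITerm) : ℕ → ITerm
  | 0 => t
  | k + 1 => var k

end ITerm

/-- Fixpoint variables of type `τ` in a fixpoint context. -/
inductive FVar : List Ty → Ty → Type
  | head {E : List Ty} {τ : Ty} : FVar (τ :: E) τ
  | tail {E : List Ty} {σ τ : Ty} : FVar E τ → FVar (σ :: E) τ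

/-- The modalities `⟨π₁⟩, ⟨π₂⟩, ⟨in₁⟩, ⟨in₂⟩, ⟨fold⟩`: a `Modality σ τ` takes formulae of type `σ`
to formulae of type `τ`. -/
inductive Modality : Ty → Ty → Type
  | pi1 {σ τ : Ty} : Modality σ (.prod σ τ)
  | pi2 {σ τ : Ty} : Modality τ (.prod σ τ)
  | in1 {σ τ : Ty} : Modality σ (.sum σ τ)
  | in2 {σ τ : Ty} : Modality τ (.sum σ τ)
  | fold {τ : TyExpr 1} : Modality τ.unfolding (.recty τ)

/-- The modality is an injection. -/
def Modality.IsInj : {σ τ : Ty} → Modality σ τ → Prop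
  | _, _, .pi1 => False
  | _, _, .pi2 => False
  | _, _, .in1 => True
  | _, _, .in2 => True
  | _, _, .fold => False

/-- Raw formulae of type `τ` in a fixpoint context `E`, before polarities are taken into account.
`star` is `⟨⟨⟩⟩`, `finmu t φ` and `finnu t φ` are the bounded iterations `(μ^t X) φ` and `(ν^t X) φ`,
and `imp` is the realizability implication. -/
inductive Form : List Ty → Ty → Type
  | top {E : List Ty} {τ : Ty} : Form E τ
  | bot {E : List Ty} {τ : Ty} : Form E τ
  | and {E : List Ty} {τ : Ty} : Form E τ → Form E τ → Form E τ
  | or {E : List Ty} {τ : Ty} : Form E τ → Form E τ → Form E τ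
  | star {E : List Ty} : Form E .unit
  | modal {E : List Ty} {σ τ : Ty} : Modality σ τ → Form E σ → Form E τ
  | fvar {E : List Ty} {τ : Ty} : FVar E τ → Form E τ
  | finmu {E : List Ty} {τ : Ty} : ITerm → Form (τ :: E) τ → Form E τ
  | finnu {E : List Ty} {τ : Ty} : ITerm → Form (τ :: E) τ → Form E τ
  | ex {E : List Ty} {τ : Ty} : Form E τ → Form E τ
  | all {E : List Ty} {τ : Ty} : Form E τ → Form E τ
  | imp {E : List Ty} {σ τ : Ty} : Form [] σ → Form [] τ → Form E (.arr σ τ)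

namespace Form

/-- Substitution of iteration terms for iteration variables. -/
def isubst : {E : List Ty} → {τ : Ty} → (ℕ → ITerm) → Form E τ → Form E τ
  | _, _, _, top => top
  | _, _, _, bot => bot
  | _, _, s, and φ ψ => and (isubst s φ) (isubst s ψ)
  | _, _, s, or φ ψ => or (isubst s φ) (isubst s ψ)
  | _, _, _, star => star
  | _, _, s, modal m φ => modal m (isubst s φ)
  | _, _, _, fvar x => fvar x
  | _, _, s, finmu t φ => finmu (t.subst s) (isubst s φ)
  | _, _, s, finnu t φ => finnu (t.subst s) (isubst s φ)
  | _, _, s, ex φ => ex (isubst (ITerm.lift s) φ)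
  | _, _, s, all φ => all (isubst (ITerm.lift s) φ)
  | _, _, s, imp ψ φ => imp (isubst s ψ) (isubst s φ)

/-- `φ` seen under one more quantifier, which binds a variable that is not free in `φ`. -/
def ishift {E : List Ty} {τ : Ty} (φ : Form E τ) : Form E τ :=
  φ.isubst fun k => .var (k + 1)

/-- `φ[t / k]`, where `k` is the variable `0`. -/
def inst {E : List Ty} {τ : Ty} (φ : Form E τ) (t : ITerm) : Form E τ :=
  φ.isubst (ITerm.single t)

/-- A renaming of fixpoint variables under one more binder. -/
def liftRen {E E' : List Ty} {σ : Ty} (r : ∀ τ : Ty, FVar E τ → FVar E' τ) :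
    ∀ τ : Ty, FVar (σ :: E) τ → FVar (σ :: E') τ
  | _, .head => .head
  | _, .tail x => .tail (r _ x)

/-- Renaming of fixpoint variables. -/
def frename : {E E' : List Ty} → {τ : Ty} → (∀ τ : Ty, FVar E τ → FVar E' τ) →
    Form E τ → Form E' τ
  | _, _, _, _, top => top
  | _, _, _, _, bot => bot
  | _, _, _, r, and φ ψ => and (frename r φ) (frename r ψ)
  | _, _, _, r, or φ ψ => or (frename r φ) (frename r ψ)
  | _, _, _, _, star => star
  | _, _, _, r, modal m φ => modal m (frename r φ)
  | _, _, _, r, fvar x => fvar (r _ x)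
  | _, _, _, r, finmu t φ => finmu t (frename (liftRen r) φ)
  | _, _, _, r, finnu t φ => finnu t (frename (liftRen r) φ)
  | _, _, _, r, ex φ => ex (frename r φ)
  | _, _, _, r, all φ => all (frename r φ)
  | _, _, _, _, imp ψ φ => imp ψ φ

/-- A substitution for fixpoint variables under one more fixpoint binder. -/
def liftSub {E E' : List Ty} {σ : Ty} (s : ∀ τ : Ty, FVar E τ → Form E' τ) :
    ∀ τ : Ty, FVar (σ :: E) τ → Form (σ :: E') τ
  | _, .head => fvar .head
  | _, .tail x => (s _ x).frename fun _ y => .tail y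

/-- Capture-avoiding substitution of formulae for fixpoint variables. -/
def fsubst : {E E' : List Ty} → {τ : Ty} → (∀ τ : Ty, FVar E τ → Form E' τ) →
    Form E τ → Form E' τ
  | _, _, _, _, top => top
  | _, _, _, _, bot => bot
  | _, _, _, s, and φ ψ => and (fsubst s φ) (fsubst s ψ)
  | _, _, _, s, or φ ψ => or (fsubst s φ) (fsubst s ψ)
  | _, _, _, _, star => star
  | _, _, _, s, modal m φ => modal m (fsubst s φ)
  | _, _, _, s, fvar x => s _ x
  | _, _, _, s, finmu t φ => finmu t (fsubst (liftSub s) φ)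
  | _, _, _, s, finnu t φ => finnu t (fsubst (liftSub s) φ)
  | _, _, _, s, ex φ => ex (fsubst (fun τ x => (s τ x).ishift) φ)
  | _, _, _, s, all φ => all (fsubst (fun τ x => (s τ x).ishift) φ)
  | _, _, _, _, imp ψ φ => imp ψ φ

/-- The substitution of `ψ` for the first fixpoint variable. -/
def singleSub {E : List Ty} {σ : Ty} (ψ : Form E σ) : ∀ τ : Ty, FVar (σ :: E) τ → Form E τ
  | _, .head => ψ
  | _, .tail x => fvar x

/-- `φ[ψ / X]`, where `X` is the first fixpoint variable. -/
def finst {E : List Ty} {σ τ : Ty} (φ : Form (σ :: E) τ) (ψ : Form E σ) : Form E τ :=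
  φ.fsubst (singleSub ψ)

/-- The iteration variable `k` is free in the formula. -/
def Occurs : {E : List Ty} → {τ : Ty} → ℕ → Form E τ → Prop
  | _, _, _, top => False
  | _, _, _, bot => False
  | _, _, k, and φ ψ => Occurs k φ ∨ Occurs k ψ
  | _, _, k, or φ ψ => Occurs k φ ∨ Occurs k ψ
  | _, _, _, star => False
  | _, _, k, modal _ φ => Occurs k φ
  | _, _, _, fvar _ => False
  | _, _, k, finmu t φ => t.Occurs k ∨ Occurs k φ
  | _, _, k, finnu t φ => t.Occurs k ∨ Occurs k φ
  | _, _, k, ex φ => Occurs (k + 1) φ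
  | _, _, k, all φ => Occurs (k + 1) φ
  | _, _, k, imp ψ φ => Occurs k ψ ∨ Occurs k φ

/-- Finite conjunctions; the empty one is `⊤`. -/
def bigAnd {E : List Ty} {τ : Ty} : List (Form E τ) → Form E τ
  | [] => top
  | φ :: l => and φ (bigAnd l)

end Form

open Form

mutual
/-- The iteration variable `k` occurs only positively. -/
inductive Pos : {E : List Ty} → {τ : Ty} → ℕ → Form E τ → Prop
  | fresh {E : List Ty} {τ : Ty} {k : ℕ} {φ : Form E τ} : ¬ φ.Occurs k → Pos k φ
  | and {E : List Ty} {τ : Ty} {k : ℕ} {φ ψ : Form E τ} : Pos k φ → Pos k ψ → Pos k (and φ ψ)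
  | or {E : List Ty} {τ : Ty} {k : ℕ} {φ ψ : Form E τ} : Pos k φ → Pos k ψ → Pos k (or φ ψ)
  | modal {E : List Ty} {σ τ : Ty} {k : ℕ} {m : Modality σ τ} {φ : Form E σ} :
      Pos k φ → Pos k (modal m φ)
  | imp {E : List Ty} {σ τ : Ty} {k : ℕ} {ψ : Form [] σ} {φ : Form [] τ} :
      Neg k ψ → Pos k φ → Pos k (imp ψ φ : Form E (.arr σ τ))
  | ex {E : List Ty} {τ : Ty} {k : ℕ} {φ : Form E τ} : Pos (k + 1) φ → Pos k (ex φ)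
  | finmu {E : List Ty} {τ : Ty} {k : ℕ} {t : ITerm} {φ : Form (τ :: E) τ} :
      Pos k φ → Pos k (finmu t φ)
  | finnu {E : List Ty} {τ : Ty} {k : ℕ} {t : ITerm} {φ : Form (τ :: E) τ} :
      Pos k φ → ¬ t.Occurs k → Pos k (finnu t φ)
/-- The iteration variable `k` occurs only negatively. -/
inductive Neg : {E : List Ty} → {τ : Ty} → ℕ → Form E τ → Prop
  | fresh {E : List Ty} {τ : Ty} {k : ℕ} {φ : Form E τ} : ¬ φ.Occurs k → Neg k φ
  | and {E : List Ty} {τ : Ty} {k : ℕ} {φ ψ : Form E τ} : Neg k φ → Neg k ψ → Neg k (and φ ψ)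
  | or {E : List Ty} {τ : Ty} {k : ℕ} {φ ψ : Form E τ} : Neg k φ → Neg k ψ → Neg k (or φ ψ)
  | modal {E : List Ty} {σ τ : Ty} {k : ℕ} {m : Modality σ τ} {φ : Form E σ} :
      Neg k φ → Neg k (modal m φ)
  | imp {E : List Ty} {σ τ : Ty} {k : ℕ} {ψ : Form [] σ} {φ : Form [] τ} :
      Pos k ψ → Neg k φ → Neg k (imp ψ φ : Form E (.arr σ τ))
  | all {E : List Ty} {τ : Ty} {k : ℕ} {φ : Form E τ} : Neg (k + 1) φ → Neg k (all φ)
  | finnu {E : List Ty} {τ : Ty} {k : ℕ} {t : ITerm} {φ : Form (τ :: E) τ} :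
      Neg k φ → Neg k (finnu t φ)
  | finmu {E : List Ty} {τ : Ty} {k : ℕ} {t : ITerm} {φ : Form (τ :: E) τ} :
      Neg k φ → ¬ t.Occurs k → Neg k (finmu t φ)
end

/-- Polarities: neutral, positive and negative. -/
inductive Sgn : Type
  | neutral
  | pos
  | neg

/-- The opposite polarity. -/
def Sgn.opp : Sgn → Sgn
  | neutral => neutral
  | pos => neg
  | neg => pos

/-- `Lang s φ` says that `φ` belongs to the language of formulae of polarity `s`. -/
inductive Lang : Sgn → {E : List Ty} → {τ : Ty} → Form E τ → Prop
  | top {s : Sgn} {E : List Ty} {τ : Ty} : Lang s (top : Form E τ)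
  | bot {s : Sgn} {E : List Ty} {τ : Ty} : Lang s (bot : Form E τ)
  | and {s : Sgn} {E : List Ty} {τ : Ty} {φ ψ : Form E τ} :
      Lang s φ → Lang s ψ → Lang s (and φ ψ)
  | or {s : Sgn} {E : List Ty} {τ : Ty} {φ ψ : Form E τ} :
      Lang s φ → Lang s ψ → Lang s (or φ ψ)
  | star {s : Sgn} {E : List Ty} : Lang s (star : Form E .unit)
  | modal {s : Sgn} {E : List Ty} {σ τ : Ty} {m : Modality σ τ} {φ : Form E σ} :
      Lang s φ → Lang s (modal m φ)
  | fvar {s : Sgn} {E : List Ty} {τ : Ty} (x : FVar E τ) : Lang s (fvar x)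
  | finmu {s : Sgn} {E : List Ty} {τ : Ty} {t : ITerm} {φ : Form (τ :: E) τ} :
      Lang s φ → Lang s (finmu t φ)
  | finnu {s : Sgn} {E : List Ty} {τ : Ty} {t : ITerm} {φ : Form (τ :: E) τ} :
      Lang s φ → Lang s (finnu t φ)
  | ex {E : List Ty} {τ : Ty} {φ : Form E τ} : Lang .pos φ → Pos 0 φ → Lang .pos (ex φ)
  | all {E : List Ty} {τ : Ty} {φ : Form E τ} : Lang .neg φ → Neg 0 φ → Lang .neg (all φ)
  | imp {s : Sgn} {E : List Ty} {σ τ : Ty} {ψ : Form [] σ} {φ : Form [] τ} :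
      Lang s.opp ψ → Lang s φ → Lang s (imp ψ φ : Form E (.arr σ τ))

/-- The conjunctive formulae: no disjunction, no bounded iteration, no quantifier (hence no fixpoint
and no iteration variable). -/
inductive IsConj : {τ : Ty} → Form [] τ → Prop
  | top {τ : Ty} : IsConj (top : Form [] τ)
  | bot {τ : Ty} : IsConj (bot : Form [] τ)
  | and {τ : Ty} {φ ψ : Form [] τ} : IsConj φ → IsConj ψ → IsConj (and φ ψ)
  | star : IsConj star
  | modal {σ τ : Ty} {m : Modality σ τ} {φ : Form [] σ} : IsConj φ → IsConj (modal m φ)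
  | imp {σ τ : Ty} {ψ : Form [] σ} {φ : Form [] τ} : IsConj ψ → IsConj φ → IsConj (imp ψ φ)

/-! ### Deduction -/

/-- `ψ ⊢ φ` is a sequent if both formulae belong to the language of one and the same polarity. -/
def IsSequent {E : List Ty} {τ : Ty} (ψ φ : Form E τ) : Prop :=
  ∃ s : Sgn, Lang s ψ ∧ Lang s φ

mutual
/-- `Ded ψ φ`: the sequent `ψ ⊢ φ` is derivable.  Side conditions `k ∉ FV(θ)` are expressed by
writing `θ.ishift` under the binder of `k`. -/
inductive Ded : {E : List Ty} → {τ : Ty} → Form E τ → Form E τ → Prop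
  -- propositional rules
  | refl {E : List Ty} {τ : Ty} {φ : Form E τ} : IsSequent φ φ → Ded φ φ
  | cut {E : List Ty} {τ : Ty} {ψ θ φ : Form E τ} : IsSequent ψ φ → Ded ψ θ → Ded θ φ → Ded ψ φ
  | distrib {E : List Ty} {τ : Ty} {ψ φ θ : Form E τ} :
      IsSequent (and ψ (or φ θ)) (or (and ψ φ) (and ψ θ)) →
      Ded (and ψ (or φ θ)) (or (and ψ φ) (and ψ θ))
  | andR {E : List Ty} {τ : Ty} {ψ φ₁ φ₂ : Form E τ} : IsSequent ψ (and φ₁ φ₂) →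
      Ded ψ φ₁ → Ded ψ φ₂ → Ded ψ (and φ₁ φ₂)
  | andL₁ {E : List Ty} {τ : Ty} {ψ₁ ψ₂ φ : Form E τ} : IsSequent (and ψ₁ ψ₂) φ →
      Ded ψ₁ φ → Ded (and ψ₁ ψ₂) φ
  | andL₂ {E : List Ty} {τ : Ty} {ψ₁ ψ₂ φ : Form E τ} : IsSequent (and ψ₁ ψ₂) φ →
      Ded ψ₂ φ → Ded (and ψ₁ ψ₂) φ
  | topR {E : List Ty} {τ : Ty} {ψ : Form E τ} : IsSequent ψ top → Ded ψ top
  | orR₁ {E : List Ty} {τ : Ty} {ψ φ₁ φ₂ : Form E τ} : IsSequent ψ (or φ₁ φ₂) →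
      Ded ψ φ₁ → Ded ψ (or φ₁ φ₂)
  | orR₂ {E : List Ty} {τ : Ty} {ψ φ₁ φ₂ : Form E τ} : IsSequent ψ (or φ₁ φ₂) →
      Ded ψ φ₂ → Ded ψ (or φ₁ φ₂)
  | orL {E : List Ty} {τ : Ty} {ψ₁ ψ₂ φ : Form E τ} : IsSequent (or ψ₁ ψ₂) φ →
      Ded ψ₁ φ → Ded ψ₂ φ → Ded (or ψ₁ ψ₂) φ
  | botL {E : List Ty} {τ : Ty} {φ : Form E τ} : IsSequent bot φ → Ded bot φ
  -- modal rules
  | injDisj {E : List Ty} {σ τ : Ty} {φ : Form E σ} {ψ : Form E τ} :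
      IsSequent (and (modal .in1 φ) (modal .in2 ψ)) bot →
      Ded (and (modal .in1 φ) (modal .in2 ψ)) bot
  | modalMono {E : List Ty} {σ τ : Ty} {m : Modality σ τ} {ψ φ : Form E σ} :
      IsSequent (modal m ψ) (modal m φ) → Ded ψ φ → Ded (modal m ψ) (modal m φ)
  | impMono {E : List Ty} {σ τ : Ty} {ψ ψ' : Form [] σ} {φ φ' : Form [] τ} :
      IsSequent (imp ψ φ : Form E (.arr σ τ)) (imp ψ' φ') →
      Ded ψ' ψ → Ded φ φ' → Ded (imp ψ φ : Form E (.arr σ τ)) (imp ψ' φ')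
  | modalAnd {E : List Ty} {σ τ : Ty} {m : Modality σ τ} {φ₁ φ₂ : Form E σ} :
      IsSequent (and (modal m φ₁) (modal m φ₂)) (modal m (and φ₁ φ₂)) →
      Ded (and (modal m φ₁) (modal m φ₂)) (modal m (and φ₁ φ₂))
  | modalTop {E : List Ty} {σ τ : Ty} {m : Modality σ τ} : ¬ m.IsInj →
      IsSequent (top : Form E τ) (modal m top) → Ded (top : Form E τ) (modal m top)
  | modalAll {E : List Ty} {σ τ : Ty} {m : Modality σ τ} {φ : Form E σ} :
      IsSequent (all (modal m φ)) (modal m (all φ)) → Ded (all (modal m φ)) (modal m (all φ))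
  | modalOr {E : List Ty} {σ τ : Ty} {m : Modality σ τ} {φ₁ φ₂ : Form E σ} :
      IsSequent (modal m (or φ₁ φ₂)) (or (modal m φ₁) (modal m φ₂)) →
      Ded (modal m (or φ₁ φ₂)) (or (modal m φ₁) (modal m φ₂))
  | modalBot {E : List Ty} {σ τ : Ty} {m : Modality σ τ} :
      IsSequent (modal m bot : Form E τ) bot → Ded (modal m bot : Form E τ) bot
  | modalEx {E : List Ty} {σ τ : Ty} {m : Modality σ τ} {φ : Form E σ} :
      IsSequent (modal m (ex φ)) (ex (modal m φ)) → Ded (modal m (ex φ)) (ex (modal m φ))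
  -- quantifier rules
  | exR {E : List Ty} {τ : Ty} {ψ φ : Form E τ} (t : ITerm) : IsSequent ψ (ex φ) →
      Ded ψ (φ.inst t) → Ded ψ (ex φ)
  | exL {E : List Ty} {τ : Ty} {θ φ ψ : Form E τ} : IsSequent (and θ (ex φ)) ψ →
      Ded (and θ.ishift φ) ψ.ishift → Ded (and θ (ex φ)) ψ
  | exMerge {E : List Ty} {τ : Ty} {φ : Form E τ} :
      IsSequent (ex (ex φ)) (ex (φ.inst (.var 0))) → Ded (ex (ex φ)) (ex (φ.inst (.var 0)))
  | allL {E : List Ty} {τ : Ty} {φ ψ : Form E τ} (t : ITerm) : IsSequent (all φ) ψ →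
      Ded (φ.inst t) ψ → Ded (all φ) ψ
  | allR {E : List Ty} {τ : Ty} {ψ φ θ : Form E τ} : IsSequent ψ (or (all φ) θ) →
      Ded ψ.ishift (or φ θ.ishift) → Ded ψ (or (all φ) θ)
  | allMerge {E : List Ty} {τ : Ty} {φ : Form E τ} :
      IsSequent (all (φ.inst (.var 0))) (all (all φ)) → Ded (all (φ.inst (.var 0))) (all (all φ))
  | finmuEx {E : List Ty} {τ : Ty} {t : ITerm} {φ : Form (τ :: E) τ} :
      IsSequent (finmu t (ex φ)) (ex (finmu t.shift φ)) →
      Ded (finmu t (ex φ)) (ex (finmu t.shift φ))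
  | finnuEx {E : List Ty} {τ : Ty} {t : ITerm} {φ : Form (τ :: E) τ} :
      IsSequent (finnu t (ex φ)) (ex (finnu t.shift φ)) →
      Ded (finnu t (ex φ)) (ex (finnu t.shift φ))
  | allFinmu {E : List Ty} {τ : Ty} {t : ITerm} {φ : Form (τ :: E) τ} :
      IsSequent (all (finmu t.shift φ)) (finmu t (all φ)) →
      Ded (all (finmu t.shift φ)) (finmu t (all φ))
  | allFinnu {E : List Ty} {τ : Ty} {t : ITerm} {φ : Form (τ :: E) τ} :
      IsSequent (all (finnu t.shift φ)) (finnu t (all φ)) →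
      Ded (all (finnu t.shift φ)) (finnu t (all φ))
  -- bounded iteration
  | finmuZero {E : List Ty} {τ : Ty} {φ : Form (τ :: E) τ} :
      IsSequent (finmu .zero φ) bot → Ded (finmu .zero φ) bot
  | finmuSuccL {E : List Ty} {τ : Ty} {t : ITerm} {φ : Form (τ :: E) τ} {ψ : Form E τ} :
      IsSequent (finmu (.succ t) φ) (φ.finst ψ) →
      Ded (finmu t φ) ψ → Ded (finmu (.succ t) φ) (φ.finst ψ)
  | finmuSuccR {E : List Ty} {τ : Ty} {t : ITerm} {φ : Form (τ :: E) τ} :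
      IsSequent (φ.finst (finmu t φ)) (finmu (.succ t) φ) →
      Ded (φ.finst (finmu t φ)) (finmu (.succ t) φ)
  | finmuMono {E : List Ty} {τ : Ty} {t : ITerm} {ψ φ : Form (τ :: E) τ} :
      IsSequent (finmu t ψ) (finmu t φ) → Ded ψ φ → Ded (finmu t ψ) (finmu t φ)
  | finnuZero {E : List Ty} {τ : Ty} {φ : Form (τ :: E) τ} :
      IsSequent top (finnu .zero φ) → Ded top (finnu .zero φ)
  | finnuSuccR {E : List Ty} {τ : Ty} {t : ITerm} {φ : Form (τ :: E) τ} {ψ : Form E τ} :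
      IsSequent (φ.finst ψ) (finnu (.succ t) φ) →
      Ded ψ (finnu t φ) → Ded (φ.finst ψ) (finnu (.succ t) φ)
  | finnuSuccL {E : List Ty} {τ : Ty} {t : ITerm} {φ : Form (τ :: E) τ} :
      IsSequent (finnu (.succ t) φ) (φ.finst (finnu t φ)) →
      Ded (finnu (.succ t) φ) (φ.finst (finnu t φ))
  | finnuMono {E : List Ty} {τ : Ty} {t : ITerm} {ψ φ : Form (τ :: E) τ} :
      IsSequent (finnu t ψ) (finnu t φ) → Ded ψ φ → Ded (finnu t ψ) (finnu t φ)
  -- realizability implication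
  | impWF {E : List Ty} {σ τ : Ty} {ψ : Form [] σ} {φ : Form [] τ} :
      IsSequent (imp (all ψ) φ : Form E (.arr σ τ)) (ex (imp ψ φ.ishift)) →
      Ded (imp (all ψ) φ : Form E (.arr σ τ)) (ex (imp ψ φ.ishift))
  | impCC {E : List Ty} {σ τ : Ty} {ψ : Form [] σ} {φ : Form [] τ} : Lang .neutral ψ →
      IsSequent (imp ψ (ex φ) : Form E (.arr σ τ)) (ex (imp ψ.ishift φ)) →
      Ded (imp ψ (ex φ) : Form E (.arr σ τ)) (ex (imp ψ.ishift φ))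
  | exImp {E : List Ty} {σ τ : Ty} {ψ : Form [] σ} {φ : Form [] τ} :
      IsSequent (all (imp ψ φ.ishift) : Form E (.arr σ τ)) (imp (ex ψ) φ) →
      Ded (all (imp ψ φ.ishift) : Form E (.arr σ τ)) (imp (ex ψ) φ)
  | impAll {E : List Ty} {σ τ : Ty} {ψ : Form [] σ} {φ : Form [] τ} :
      IsSequent (all (imp ψ.ishift φ) : Form E (.arr σ τ)) (imp ψ (all φ)) →
      Ded (all (imp ψ.ishift φ) : Form E (.arr σ τ)) (imp ψ (all φ))
  | impAnd {E : List Ty} {σ τ : Ty} {ψ : Form [] σ} {φ₁ φ₂ : Form [] τ} :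
      IsSequent (and (imp ψ φ₁) (imp ψ φ₂) : Form E (.arr σ τ)) (imp ψ (and φ₁ φ₂)) →
      Ded (and (imp ψ φ₁) (imp ψ φ₂) : Form E (.arr σ τ)) (imp ψ (and φ₁ φ₂))
  | impTop {E : List Ty} {σ τ : Ty} {ψ : Form [] σ} :
      IsSequent (top : Form E (.arr σ τ)) (imp ψ top) →
      Ded (top : Form E (.arr σ τ)) (imp ψ top)
  | orImp {E : List Ty} {σ τ : Ty} {ψ₁ ψ₂ : Form [] σ} {φ : Form [] τ} :
      IsSequent (and (imp ψ₁ φ) (imp ψ₂ φ) : Form E (.arr σ τ)) (imp (or ψ₁ ψ₂) φ) →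
      Ded (and (imp ψ₁ φ) (imp ψ₂ φ) : Form E (.arr σ τ)) (imp (or ψ₁ ψ₂) φ)
  | botImp {E : List Ty} {σ τ : Ty} {φ : Form [] τ} :
      IsSequent (top : Form E (.arr σ τ)) (imp bot φ) →
      Ded (top : Form E (.arr σ τ)) (imp bot φ)
  | impOr {E : List Ty} {σ τ : Ty} {δ : Form [] σ} {φ₁ φ₂ : Form [] τ} : IsConj δ →
      IsSequent (imp δ (or φ₁ φ₂) : Form E (.arr σ τ)) (or (imp δ φ₁) (imp δ φ₂)) →
      Ded (imp δ (or φ₁ φ₂) : Form E (.arr σ τ)) (or (imp δ φ₁) (imp δ φ₂))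
  | impBot {E : List Ty} {σ τ : Ty} {δ : Form [] σ} : Cons δ → IsConj δ →
      IsSequent (imp δ bot : Form E (.arr σ τ)) bot →
      Ded (imp δ bot : Form E (.arr σ τ)) bot
/-- The consistency predicate `C(φ)`, on conjunctive formulae. -/
inductive Cons : {τ : Ty} → Form [] τ → Prop
  | star : Cons star
  | fold {τ : TyExpr 1} {φ : Form [] τ.unfolding} : Cons φ → Cons (modal .fold φ)
  | pair {σ τ : Ty} {φ : Form [] σ} {ψ : Form [] τ} : Cons φ → Cons ψ →
      Cons (and (modal .pi1 φ) (modal .pi2 ψ))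
  | in1 {σ τ : Ty} {φ : Form [] σ} : Cons φ → Cons (modal (.in1 : Modality σ (.sum σ τ)) φ)
  | in2 {σ τ : Ty} {φ : Form [] τ} : Cons φ → Cons (modal (.in2 : Modality τ (.sum σ τ)) φ)
  | top {τ : Ty} : Cons (top : Form [] τ)
  | ded {τ : Ty} {ψ φ : Form [] τ} : Cons ψ → Ded ψ φ → IsConj φ → Cons φ
  | imp {σ τ : Ty} (I : List (Form [] σ × Form [] τ)) :
      (∀ p ∈ I, Cons p.1) → (∀ p ∈ I, Cons p.2) → (∀ J, J.Sublist I → Coherent J) →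
      Cons (bigAnd (I.map fun p => imp p.1 p.2))
/-- For a finite family `J` of pairs `(ψ, φ)`: either `⋀ ψ ⊢ ⊥` is derivable, or `C(⋀ φ)` is. -/
inductive Coherent : {σ τ : Ty} → List (Form [] σ × Form [] τ) → Prop
  | incons {σ τ : Ty} {J : List (Form [] σ × Form [] τ)} :
      Ded (bigAnd (J.map Prod.fst)) bot → Coherent J
  | cons {σ τ : Ty} {J : List (Form [] σ × Form [] τ)} :
      Cons (bigAnd (J.map Prod.snd)) → Coherent J
end

/-! ### Semantics of formulae -/

/-- The semantic modalities. -/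
def Modality.sem : {σ τ : Ty} → Modality σ τ → Set (den σ) → Set (den τ)
  | _, _, @Modality.pi1 σ τ, S => {x : den σ × den τ | x.1 ∈ S}
  | _, _, @Modality.pi2 σ τ, S => {x : den σ × den τ | x.2 ∈ S}
  | _, _, @Modality.in1 σ τ, S =>
      (fun x : den σ => ((Sum.inl x : den σ ⊕ den τ) : WithBot (den σ ⊕ den τ))) '' S
  | _, _, @Modality.in2 σ τ, S =>
      (fun x : den τ => ((Sum.inr x : den σ ⊕ den τ) : WithBot (den σ ⊕ den τ))) '' S
  | _, _, @Modality.fold τ, S => {x : den (.recty τ) | unfold τ x ∈ S}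

/-- Valuations of the fixpoint variables of a context. -/
abbrev Val (E : List Ty) : Type := ∀ σ : Ty, FVar E σ → Set (den σ)

def Val.nil : Val [] := fun _ x => nomatch x

def Val.cons {E : List Ty} {σ : Ty} (S : Set (den σ)) (ρ : Val E) : Val (σ :: E)
  | _, .head => S
  | _, .tail x => ρ _ x

/-- Extension of a valuation of the iteration variables at index `0`. -/
def consI (n : ℕ) (v : ℕ → ℕ) : ℕ → ℕ
  | 0 => n
  | k + 1 => v k

/-- The interpretation of a formula under a valuation. -/
def Form.sem : {E : List Ty} → {τ : Ty} → Form E τ → Val E → (ℕ → ℕ) → Set (den τ)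
  | _, _, .top, _, _ => Set.univ
  | _, _, .bot, _, _ => ∅
  | _, _, .and φ ψ, ρ, v => φ.sem ρ v ∩ ψ.sem ρ v
  | _, _, .or φ ψ, ρ, v => φ.sem ρ v ∪ ψ.sem ρ v
  | _, _, .star, _, _ => ({true} : Set Bool)
  | _, _, .modal m φ, ρ, v => m.sem (φ.sem ρ v)
  | _, _, .fvar x, ρ, _ => ρ _ x
  | _, _, .finmu t φ, ρ, v => (fun S => φ.sem (Val.cons S ρ) v)^[t.eval v] ∅
  | _, _, .finnu t φ, ρ, v => (fun S => φ.sem (Val.cons S ρ) v)^[t.eval v] Set.univ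
  | _, _, .ex φ, ρ, v => ⋃ n : ℕ, φ.sem ρ (consI n v)
  | _, _, .all φ, ρ, v => ⋂ n : ℕ, φ.sem ρ (consI n v)
  | _, _, @Form.imp _ σ τ ψ φ, _, v =>
      {f : ScottMap (den σ) (den τ) | ∀ x ∈ ψ.sem Val.nil v, f.val x ∈ φ.sem Val.nil v}

end PosLog

end

/-!
Completeness is proved by induction on the nesting depth of modalities and implications.
Propositional reasoning brings a conjunctive formula to a normal form dictated by its type: `⊤`,
`⊥`, `⟨⟨⟩⟩`, `⟨π₁⟩α ∧ ⟨π₂⟩β`, `⟨in₁⟩α`, `⟨in₂⟩β`, `⟨fold⟩α` or a finite conjunction `⋀ (ψᵢ ⊩ φᵢ)`.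
The components of normal forms have smaller depth, and everything but the arrow type is immediate
from the behaviour of the modalities.

For a family of implications the induction carries along that each formula denotes a Scott-open
set, with a least element unless it is empty. If for every `x` the conclusions whose premises hold
at `x` are jointly satisfiable, sending `x` to the least element satisfying them is
Scott-continuous, since the conjunction of the premises that hold at `x` is an open neighbourhood
of `x`. This step function is the least realizer of the family, so `⋀ (ψᵢ ⊩ φᵢ)` implies `α ⊩ β`
only if `β` follows from the conclusions that are active at the least element of `α`. If instead
the active conclusions are contradictory at some `x`, then the premises active at `x` are
consistent by induction, and `(δ ⊩ ⊥) ⊢ ⊥` refutes the family.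
-/

noncomputable section
namespace PosLog
open Form
open scoped Topology

/-! ### Scott domains and their open sets -/

section Scott

variable {X Y : Type} [PartialOrder X] [PartialOrder Y]

/-- The Scott-open subsets of a partial order. -/
def IsScottOpen (S : Set X) : Prop := IsOpen[Topology.scott X Set.univ] S

theorem isScottOpen_iff {S : Set X} : IsScottOpen S ↔ IsUpperSet S ∧ DirSupInacc S := by
  let _ : TopologicalSpace X := Topology.scott X Set.univ
  have : Topology.IsScott X Set.univ := ⟨rfl⟩
  rw [← dirSupInaccOn_univ]
  exact Topology.IsScott.isOpen_iff_isUpperSet_and_dirSupInaccOn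

theorem isScottOpen_compl_Iic (a : X) : IsScottOpen (Set.Iic a)ᶜ :=
  isScottOpen_iff.2 ⟨(isLowerSet_Iic a).compl, (dirSupClosed_Iic a).compl⟩

namespace IsScottOpen

theorem isUpperSet {S : Set X} (hS : IsScottOpen S) : IsUpperSet S := (isScottOpen_iff.1 hS).1

theorem dirSupInacc {S : Set X} (hS : IsScottOpen S) : DirSupInacc S := (isScottOpen_iff.1 hS).2

theorem univ : IsScottOpen (Set.univ : Set X) := @isOpen_univ X (Topology.scott X Set.univ)

theorem empty : IsScottOpen (∅ : Set X) := @isOpen_empty X (Topology.scott X Set.univ)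

theorem inter {S T : Set X} (hS : IsScottOpen S) (hT : IsScottOpen T) : IsScottOpen (S ∩ T) :=
  @IsOpen.inter X (Topology.scott X Set.univ) S T hS hT

theorem preimage {f : X → Y} (hf : ScottContinuous f) {S : Set Y} (hS : IsScottOpen S) :
    IsScottOpen (f ⁻¹' S) :=
  isScottOpen_iff.2 ⟨hS.isUpperSet.preimage hf.monotone, fun _ hn hd _ hx h =>
    Set.image_inter_nonempty_iff.1 (hS.dirSupInacc (hn.image f)
      (directedOn_image.2 (hd.mono fun {_ _} hxy => hf.monotone hxy)) (hf hn hd hx) h)⟩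

theorem of_isUpperSet_of_isLowerSet {S : Set X} (hu : IsUpperSet S) (hl : IsLowerSet S) :
    IsScottOpen S :=
  isScottOpen_iff.2 ⟨hu, fun _ hn _ _ hx h => hn.imp fun _ hz => ⟨hz, hl (hx.1 hz) h⟩⟩

theorem image (f : X ↪o Y) (hf : IsScottOpen (Set.range f)) {S : Set X} (hS : IsScottOpen S) :
    IsScottOpen (f '' S) := by
  refine isScottOpen_iff.2 ⟨?_, fun d hn hd y hy h => ?_⟩
  · rintro _ y h ⟨a, ha, rfl⟩
    obtain ⟨b, rfl⟩ := hf.isUpperSet h ⟨a, rfl⟩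
    exact ⟨b, hS.isUpperSet (f.le_iff_le.1 h) ha, rfl⟩
  · obtain ⟨a, ha, rfl⟩ := h
    obtain ⟨_, hb, b, rfl⟩ := hf.dirSupInacc hn hd hy ⟨a, rfl⟩
    have hdir : DirectedOn (· ≤ ·) (f ⁻¹' d) := fun x hx y hy => by
      obtain ⟨w, hw, hxw, hyw⟩ := hd _ hx _ hy
      obtain ⟨c, rfl⟩ := hf.isUpperSet hxw ⟨x, rfl⟩
      exact ⟨c, hw, f.le_iff_le.1 hxw, f.le_iff_le.1 hyw⟩
    have hlub : IsLUB (f ⁻¹' d) a := by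
      refine ⟨fun z hz => f.le_iff_le.1 (hy.1 hz), fun c hc => f.le_iff_le.1 (hy.2 fun z hz => ?_)⟩
      obtain ⟨w, hw, hzw, hbw⟩ := hd z hz _ hb
      obtain ⟨e, rfl⟩ := hf.isUpperSet hbw ⟨b, rfl⟩
      exact hzw.trans (f.le_iff_le.2 (hc hw))
    obtain ⟨z, hz, hzS⟩ := hS.dirSupInacc ⟨b, hb⟩ hdir hlub ha
    exact ⟨f z, hz, z, hzS, rfl⟩

theorem image_coe {S : Set X} (hS : IsScottOpen S) :
    IsScottOpen ((fun x : X => (x : WithBot X)) '' S) := by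
  refine image WithBot.coeOrderHom ?_ hS
  convert isScottOpen_compl_Iic (⊥ : WithBot X) using 1
  ext x
  cases x <;> simp

theorem image_inl {S : Set X} (hS : IsScottOpen S) :
    IsScottOpen ((Sum.inl : X → X ⊕ Y) '' S) := by
  refine image ⟨⟨Sum.inl, Sum.inl_injective⟩, Sum.inl_le_inl_iff⟩
    (of_isUpperSet_of_isLowerSet ?_ ?_) hS
  · rintro _ (b | b) h ⟨a, rfl⟩
    exacts [⟨b, rfl⟩, absurd h Sum.not_inl_le_inr]
  · rintro _ (b | b) h ⟨a, rfl⟩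
    exacts [⟨b, rfl⟩, absurd h Sum.not_inr_le_inl]

theorem image_inr {S : Set Y} (hS : IsScottOpen S) :
    IsScottOpen ((Sum.inr : Y → X ⊕ Y) '' S) := by
  refine image ⟨⟨Sum.inr, Sum.inr_injective⟩, Sum.inr_le_inr_iff⟩
    (of_isUpperSet_of_isLowerSet ?_ ?_) hS
  · rintro _ (b | b) h ⟨a, rfl⟩
    exacts [absurd h Sum.not_inr_le_inl, ⟨b, rfl⟩]
  · rintro _ (b | b) h ⟨a, rfl⟩
    exacts [absurd h Sum.not_inl_le_inr, ⟨b, rfl⟩]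

end IsScottOpen

theorem isScottOpen_singleton_true : IsScottOpen ({true} : Set Bool) := by
  convert isScottOpen_compl_Iic false using 1
  ext b
  cases b <;> simp

theorem scottContinuous_of_isScottOpen_nhds {u : X → Y}
    (h : ∀ x, ∃ U, IsScottOpen U ∧ x ∈ U ∧ ∀ y ∈ U, u x ≤ u y) : ScottContinuous u := by
  have hmono : Monotone u := fun x y hxy => by
    obtain ⟨U, hU, hx, hle⟩ := h x
    exact hle y (hU.isUpperSet hxy hx)
  intro d hn hd x hx
  refine ⟨hmono.mem_upperBounds_image hx.1, fun b hb => ?_⟩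
  obtain ⟨U, hU, hxU, hle⟩ := h x
  obtain ⟨z, hz, hzU⟩ := hU.dirSupInacc hn hd hx hxU
  exact (hle z hzU).trans (hb ⟨z, hz, rfl⟩)

variable (X) in
/-- Every nonempty directed subset has a least upper bound. The existence of suprema is a property
here, in contrast to the operation provided by `CompletePartialOrder`. -/
def IsDirectedComplete : Prop :=
  ∀ d : Set X, d.Nonempty → DirectedOn (· ≤ ·) d → ∃ x, IsLUB d x

theorem IsDirectedComplete.of_orderIso (e : X ≃o Y) (hX : IsDirectedComplete X) :
    IsDirectedComplete Y := fun d hn hd => by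
  obtain ⟨x, hx⟩ := hX (e.symm '' d) (hn.image _)
    (directedOn_image.2 (hd.mono fun {_ _} h => e.symm.monotone h))
  exact ⟨e x, e.symm.isLUB_image.1 hx⟩

theorem directedOn_image_apply {d : Set (ScottMap X Y)} (hd : DirectedOn (· ≤ ·) d) (x : X) :
    DirectedOn (· ≤ ·) ((fun f : ScottMap X Y => f.val x) '' d) :=
  directedOn_image.2 (hd.mono fun {_ _} h => h x)

theorem scottContinuous_of_forall_isLUB {d : Set (ScottMap X Y)} {u : X → Y}
    (hu : ∀ x, IsLUB ((fun f : ScottMap X Y => f.val x) '' d) (u x)) : ScottContinuous u := by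
  intro s hs hsd x hx
  refine ⟨Set.forall_mem_image.2 fun z hz => (hu z).2 (Set.forall_mem_image.2 fun f hf => ?_),
    fun y hy => (hu x).2 (Set.forall_mem_image.2 fun f hf => ?_)⟩
  · exact (f.property.monotone (hx.1 hz)).trans ((hu x).1 ⟨f, hf, rfl⟩)
  · exact (f.property hs hsd hx).2 (Set.forall_mem_image.2 fun z hz =>
      ((hu z).1 ⟨f, hf, rfl⟩).trans (hy ⟨z, hz, rfl⟩))

theorem scottContinuous_apply (hY : IsDirectedComplete Y) (x : X) :
    ScottContinuous (fun f : ScottMap X Y => f.val x) := by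
  intro d hn hd f hf
  choose u hu using fun x => hY _ (hn.image fun g : ScottMap X Y => g.val x)
    (directedOn_image_apply hd x)
  have hlub : IsLUB d (⟨u, scottContinuous_of_forall_isLUB hu⟩ : ScottMap X Y) :=
    ⟨fun g hg x => (hu x).1 ⟨g, hg, rfl⟩,
      fun _ hg x => (hu x).2 (Set.forall_mem_image.2 fun _ hh => hg hh x)⟩
  rw [← hlub.unique hf]
  exact hu x

theorem IsScottOpen.setOf_forall_mem (hY : IsDirectedComplete Y) {S : Set X} {a : X}
    (ha : IsLeast S a) {U : Set Y} (hU : IsScottOpen U) :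
    IsScottOpen {f : ScottMap X Y | ∀ x ∈ S, f.val x ∈ U} := by
  convert hU.preimage (scottContinuous_apply hY a) using 1
  ext f
  exact ⟨fun hf => hf a ha.1,
    fun hf _ hx => hU.isUpperSet (f.property.monotone (ha.2 hx)) hf⟩

end Scott

section Den

variable {m : ℕ} (τ : TyExpr m)

theorem Lim.exists_forall_val_le {τ : TyExpr m} {d : Set (Lim τ)} (hn : d.Nonempty)
    (hd : DirectedOn (· ≤ ·) d) (n : ℕ) : ∃ y ∈ d, ∀ z ∈ d, z.1 n ≤ y.1 n := by
  obtain ⟨_, ⟨y, hy, rfl⟩, hmax⟩ :=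
    (Set.toFinite ((fun z : Lim τ => z.1 n) '' d)).exists_maximal (hn.image _)
  refine ⟨y, hy, fun z hz => ?_⟩
  obtain ⟨w, hw, hyw, hzw⟩ := hd y hy z hz
  exact (hzw n).trans (hmax ⟨w, hw, rfl⟩ (hyw n))

theorem Lim.isDirectedComplete : IsDirectedComplete (Lim τ) := fun d hn hd => by
  choose w hw hmax using Lim.exists_forall_val_le hn hd
  exact ⟨⟨fun n => (w n).1 n, fun n k hk => le_antisymm
    (((w n).2 n k hk).trans_le (hmax k _ (hw n)))
    (((w k).2 n k hk).symm.trans_le ((tr n k τ).monotone (hmax n _ (hw k))))⟩,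
    fun z hz n => hmax n z hz, fun y hy n => hy (hw n) n⟩

theorem isDirectedComplete_den : IsDirectedComplete (den τ) :=
  (Lim.isDirectedComplete τ).of_orderIso (conv τ)

theorem exists_isBot_den : ∃ x : den τ, IsBot x :=
  ⟨conv τ (Lim.emb τ 0 ⊥), fun y => by
    rw [← (conv τ).symm.le_iff_le, OrderIso.symm_apply_apply]
    exact fun _ => bot_le⟩

instance : Nonempty (den τ) := (exists_isBot_den τ).nonempty

end Den

/-! ### Modalities -/

namespace Modality

variable {σ τ : Ty} (m : Modality σ τ) {S T : Set (den σ)}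

theorem coe_inl_injective (X Y : Type) :
    Function.Injective fun x : X => ((Sum.inl x : X ⊕ Y) : WithBot (X ⊕ Y)) :=
  WithBot.coe_injective.comp Sum.inl_injective

theorem coe_inr_injective (X Y : Type) :
    Function.Injective fun y : Y => ((Sum.inr y : X ⊕ Y) : WithBot (X ⊕ Y)) :=
  WithBot.coe_injective.comp Sum.inr_injective

theorem sem_subset_sem_iff : m.sem S ⊆ m.sem T ↔ S ⊆ T := by
  cases m with
  | pi1 => exact Prod.fst_surjective.preimage_subset_preimage_iff
  | pi2 => exact Prod.snd_surjective.preimage_subset_preimage_iff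
  | in1 => exact Set.image_subset_image_iff (coe_inl_injective _ _)
  | in2 => exact Set.image_subset_image_iff (coe_inr_injective _ _)
  | fold => exact (unfold _).surjective.preimage_subset_preimage_iff

theorem sem_inter : m.sem (S ∩ T) = m.sem S ∩ m.sem T := by
  cases m with
  | pi1 => rfl
  | pi2 => rfl
  | in1 => exact Set.image_inter (coe_inl_injective _ _)
  | in2 => exact Set.image_inter (coe_inr_injective _ _)
  | fold => rfl

theorem sem_empty : m.sem ∅ = ∅ := by
  cases m with
  | pi1 => rfl
  | pi2 => rfl
  | in1 => exact Set.image_empty _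
  | in2 => exact Set.image_empty _
  | fold => rfl

theorem sem_univ_eq_univ_iff : m.sem Set.univ = Set.univ ↔ ¬ m.IsInj := by
  cases m with
  | pi1 => exact iff_of_true rfl id
  | pi2 => exact iff_of_true rfl id
  | in1 =>
    refine iff_of_false (fun h => ?_) (not_not_intro trivial)
    obtain ⟨_, _, h⟩ := h.ge (Set.mem_univ (⊥ : WithBot _))
    exact WithBot.coe_ne_bot h
  | in2 =>
    refine iff_of_false (fun h => ?_) (not_not_intro trivial)
    obtain ⟨_, _, h⟩ := h.ge (Set.mem_univ (⊥ : WithBot _))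
    exact WithBot.coe_ne_bot h
  | fold => exact iff_of_true rfl id

theorem sem_eq_empty_iff : m.sem S = ∅ ↔ S = ∅ := by
  rw [← Set.subset_empty_iff, ← m.sem_empty, sem_subset_sem_iff, Set.subset_empty_iff]

theorem sem_nonempty_iff : (m.sem S).Nonempty ↔ S.Nonempty := by
  rw [Set.nonempty_iff_ne_empty, Set.nonempty_iff_ne_empty, ne_eq, sem_eq_empty_iff]

theorem disjoint_sem_in1_sem_in2 {σ τ : Ty} (S : Set (den σ)) (T : Set (den τ)) :
    Disjoint (in1.sem S : Set (den (.sum σ τ))) (in2.sem T) := by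
  refine Set.disjoint_left.2 ?_
  rintro _ ⟨a, _, rfl⟩ ⟨b, _, hab⟩
  exact Sum.inr_ne_inl (WithBot.coe_injective hab)

theorem isScottOpen_sem (hS : IsScottOpen S) : IsScottOpen (m.sem S) := by
  cases m with
  | pi1 => exact hS.preimage ScottContinuous.fst
  | pi2 => exact hS.preimage ScottContinuous.snd
  | @in1 σ τ =>
    have h := (hS.image_inl (Y := den τ)).image_coe
    rwa [Set.image_image] at h
  | @in2 σ τ =>
    have h := (hS.image_inr (X := den σ)).image_coe
    rwa [Set.image_image] at h
  | fold => exact hS.preimage (orderIso_scottContinuous (unfold _))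

end Modality

/-! ### Valid and derivable sequents -/

theorem IsConj.lang {τ : Ty} {φ : Form [] τ} (h : IsConj φ) (s : Sgn) : Lang s φ := by
  induction h generalizing s with
  | top => exact .top
  | bot => exact .bot
  | and _ _ h₁ h₂ => exact .and (h₁ s) (h₂ s)
  | star => exact .star
  | modal _ h => exact .modal (h s)
  | imp _ _ h₁ h₂ => exact .imp (h₁ s.opp) (h₂ s)

theorem IsConj.isSequent {τ : Ty} {φ ψ : Form [] τ} (hψ : IsConj ψ) (hφ : IsConj φ) :
    IsSequent ψ φ := ⟨.neutral, hψ.lang _, hφ.lang _⟩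

/-- A sequent `ψ ⊢ φ` between conjunctive formulae that is both derivable and valid under the
valuation `v`. Carrying validity along with each derivation makes a soundness proof for the whole
calculus unnecessary. -/
structure Entails (v : ℕ → ℕ) {τ : Ty} (ψ φ : Form [] τ) : Prop where
  left : IsConj ψ
  right : IsConj φ
  ded : Ded ψ φ
  subset : ψ.sem Val.nil v ⊆ φ.sem Val.nil v

/-- Interderivability of conjunctive formulae, with validity under `v` in both directions. -/
structure Equivalent (v : ℕ → ℕ) {τ : Ty} (φ ψ : Form [] τ) : Prop where
  mp : Entails v φ ψ
  mpr : Entails v ψ φ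

section

variable {v : ℕ → ℕ} {σ τ : Ty} {φ ψ θ φ₁ φ₂ φ₃ φ₄ ψ₁ ψ₂ : Form [] τ} {α β : Form [] σ}

local notation "⟦" φ "⟧ᵛ" => Form.sem φ Val.nil v

namespace Entails

theorem of_isSequent (hψ : IsConj ψ) (hφ : IsConj φ) (hd : IsSequent ψ φ → Ded ψ φ)
    (hs : ⟦ψ⟧ᵛ ⊆ ⟦φ⟧ᵛ) : Entails v ψ φ := ⟨hψ, hφ, hd (hψ.isSequent hφ), hs⟩

theorem refl (h : IsConj φ) : Entails v φ φ := of_isSequent h h .refl subset_rfl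

theorem trans (h : Entails v ψ θ) (h' : Entails v θ φ) : Entails v ψ φ :=
  of_isSequent h.left h'.right (.cut · h.ded h'.ded) (h.subset.trans h'.subset)

theorem and_intro (h₁ : Entails v ψ φ₁) (h₂ : Entails v ψ φ₂) : Entails v ψ (and φ₁ φ₂) :=
  of_isSequent h₁.left (h₁.right.and h₂.right) (.andR · h₁.ded h₂.ded)
    (Set.subset_inter h₁.subset h₂.subset)

theorem and_left (h₁ : IsConj φ₁) (h₂ : IsConj φ₂) : Entails v (and φ₁ φ₂) φ₁ :=
  of_isSequent (h₁.and h₂) h₁ (.andL₁ · (refl (v := v) h₁).ded) Set.inter_subset_left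

theorem and_right (h₁ : IsConj φ₁) (h₂ : IsConj φ₂) : Entails v (and φ₁ φ₂) φ₂ :=
  of_isSequent (h₁.and h₂) h₂ (.andL₂ · (refl (v := v) h₂).ded) Set.inter_subset_right

theorem and_mono (h₁ : Entails v ψ₁ φ₁) (h₂ : Entails v ψ₂ φ₂) :
    Entails v (and ψ₁ ψ₂) (and φ₁ φ₂) :=
  ((and_left h₁.left h₂.left).trans h₁).and_intro ((and_right h₁.left h₂.left).trans h₂)

theorem to_top (h : IsConj ψ) : Entails v ψ top :=
  of_isSequent h .top .topR (Set.subset_univ _)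

theorem of_bot (h : IsConj φ) : Entails v bot φ :=
  of_isSequent .bot h .botL (Set.empty_subset _)

theorem modal_mono (m : Modality σ τ) (h : Entails v α β) :
    Entails v (modal m α) (modal m β) :=
  of_isSequent h.left.modal h.right.modal (.modalMono · h.ded) (m.sem_subset_sem_iff.2 h.subset)

theorem modal_and (m : Modality σ τ) (hα : IsConj α) (hβ : IsConj β) :
    Entails v (and (modal m α) (modal m β)) (modal m (and α β)) :=
  of_isSequent (hα.modal.and hβ.modal) (hα.and hβ).modal .modalAnd m.sem_inter.ge

theorem modal_top (m : Modality σ τ) (hm : ¬ m.IsInj) : Entails v top (modal m top) :=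
  of_isSequent .top (.modal .top) (.modalTop hm) (m.sem_univ_eq_univ_iff.2 hm).ge

theorem modal_bot (m : Modality σ τ) : Entails v (modal m bot) bot :=
  of_isSequent (.modal .bot) .bot .modalBot m.sem_empty.le

theorem in1_and_in2 {β : Form [] τ} (hα : IsConj α) (hβ : IsConj β) :
    Entails v (and (modal .in1 α) (modal .in2 β)) bot :=
  of_isSequent (hα.modal.and hβ.modal) .bot .injDisj
    (Modality.disjoint_sem_in1_sem_in2 _ _).inter_eq.le

theorem imp_mono (h : Entails v β α) (h' : Entails v φ ψ) : Entails v (imp α φ) (imp β ψ) :=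
  of_isSequent (h.right.imp h'.left) (h.left.imp h'.right) (.impMono · h.ded h'.ded)
    fun _ hf x hx => h'.subset (hf x (h.subset hx))

theorem imp_and (hα : IsConj α) (h₁ : IsConj φ₁) (h₂ : IsConj φ₂) :
    Entails v (and (imp α φ₁) (imp α φ₂)) (imp α (and φ₁ φ₂)) :=
  of_isSequent ((hα.imp h₁).and (hα.imp h₂)) (hα.imp (h₁.and h₂)) .impAnd
    fun _ hf x hx => ⟨hf.1 x hx, hf.2 x hx⟩

theorem imp_top (hα : IsConj α) : Entails v top (imp α (top : Form [] τ)) :=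
  of_isSequent .top (hα.imp .top) .impTop fun _ _ _ _ => trivial

theorem bot_imp (σ : Ty) (hφ : IsConj φ) : Entails v top (imp (bot : Form [] σ) φ) :=
  of_isSequent .top (IsConj.bot.imp hφ) .botImp fun _ _ _ hx => hx.elim

theorem imp_bot (hα : IsConj α) (hC : Cons α) (hne : ⟦α⟧ᵛ.Nonempty) :
    Entails v (imp α (bot : Form [] τ)) bot :=
  of_isSequent (hα.imp .bot) .bot (.impBot hC hα) fun _ hf => hne.elim hf

end Entails

namespace Equivalent

theorem refl (h : IsConj φ) : Equivalent v φ φ := ⟨.refl h, .refl h⟩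

theorem symm (h : Equivalent v φ ψ) : Equivalent v ψ φ := ⟨h.mpr, h.mp⟩

theorem trans (h : Equivalent v φ ψ) (h' : Equivalent v ψ θ) : Equivalent v φ θ :=
  ⟨h.mp.trans h'.mp, h'.mpr.trans h.mpr⟩

theorem sem_eq (h : Equivalent v φ ψ) : ⟦φ⟧ᵛ = ⟦ψ⟧ᵛ := h.mp.subset.antisymm h.mpr.subset

theorem and_congr (h₁ : Equivalent v φ₁ ψ₁) (h₂ : Equivalent v φ₂ ψ₂) :
    Equivalent v (and φ₁ φ₂) (and ψ₁ ψ₂) := ⟨h₁.mp.and_mono h₂.mp, h₁.mpr.and_mono h₂.mpr⟩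

theorem and_comm (h₁ : IsConj φ₁) (h₂ : IsConj φ₂) : Equivalent v (and φ₁ φ₂) (and φ₂ φ₁) :=
  ⟨(Entails.and_right h₁ h₂).and_intro (.and_left h₁ h₂),
    (Entails.and_right h₂ h₁).and_intro (.and_left h₂ h₁)⟩

theorem and_self (h : IsConj φ) : Equivalent v (and φ φ) φ :=
  ⟨.and_left h h, (Entails.refl h).and_intro (.refl h)⟩

theorem and_top (h : IsConj φ) : Equivalent v (and φ top) φ :=
  ⟨.and_left h .top, (Entails.refl h).and_intro (.to_top h)⟩

theorem and_bot (h : IsConj φ) : Equivalent v (and φ bot) bot :=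
  ⟨.and_right h .bot, .of_bot (h.and .bot)⟩

theorem and_and_and_comm (h₁ : IsConj φ₁) (h₂ : IsConj φ₂) (h₃ : IsConj φ₃) (h₄ : IsConj φ₄) :
    Equivalent v (and (and φ₁ φ₂) (and φ₃ φ₄)) (and (and φ₁ φ₃) (and φ₂ φ₄)) :=
  ⟨.and_intro (.and_mono (.and_left h₁ h₂) (.and_left h₃ h₄))
      (.and_mono (.and_right h₁ h₂) (.and_right h₃ h₄)),
    .and_intro (.and_mono (.and_left h₁ h₃) (.and_left h₂ h₄))
      (.and_mono (.and_right h₁ h₃) (.and_right h₂ h₄))⟩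

theorem modal_and (m : Modality σ τ) (hα : IsConj α) (hβ : IsConj β) :
    Equivalent v (and (modal m α) (modal m β)) (modal m (and α β)) :=
  ⟨.modal_and m hα hβ,
    .and_intro (.modal_mono m (.and_left hα hβ)) (.modal_mono m (.and_right hα hβ))⟩

theorem modal_top (m : Modality σ τ) (hm : ¬ m.IsInj) : Equivalent v top (modal m top) :=
  ⟨.modal_top m hm, .to_top (.modal .top)⟩

theorem in1_and_in2 {β : Form [] τ} (hα : IsConj α) (hβ : IsConj β) :
    Equivalent v (and (modal .in1 α) (modal .in2 β)) bot :=
  ⟨.in1_and_in2 hα hβ, .of_bot (hα.modal.and hβ.modal)⟩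

end Equivalent

/-! ### Finite conjunctions of implications -/

theorem IsConj.bigAnd {l : List (Form [] τ)} (h : ∀ φ ∈ l, IsConj φ) : IsConj (bigAnd l) := by
  induction l with
  | nil => exact .top
  | cons φ l ih =>
    rw [List.forall_mem_cons] at h
    exact h.1.and (ih h.2)

theorem mem_sem_bigAnd {l : List (Form [] τ)} {x : den τ} :
    x ∈ ⟦bigAnd l⟧ᵛ ↔ ∀ φ ∈ l, x ∈ ⟦φ⟧ᵛ := by
  induction l with
  | nil => exact iff_of_true trivial (List.forall_mem_nil _)
  | cons φ l ih =>
    rw [List.forall_mem_cons, ← ih]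
    rfl

namespace Entails

theorem bigAnd_intro {l : List (Form [] τ)} (hψ : IsConj ψ) (h : ∀ φ ∈ l, Entails v ψ φ) :
    Entails v ψ (bigAnd l) := by
  induction l with
  | nil => exact to_top hψ
  | cons φ l ih =>
    rw [List.forall_mem_cons] at h
    exact h.1.and_intro (ih h.2)

theorem bigAnd_elim {l : List (Form [] τ)} (hl : ∀ φ ∈ l, IsConj φ) (h : φ ∈ l) :
    Entails v (bigAnd l) φ := by
  induction l with
  | nil => exact absurd h List.not_mem_nil
  | cons ψ l ih =>
    rw [List.forall_mem_cons] at hl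
    rcases List.mem_cons.1 h with rfl | h
    · exact .and_left hl.1 (.bigAnd hl.2)
    · exact (and_right hl.1 (.bigAnd hl.2)).trans (ih hl.2 h)

theorem imp_bigAnd {θ : Form [] (.arr σ τ)} {l : List (Form [] τ)} (hθ : IsConj θ)
    (hα : IsConj α) (hl : ∀ φ ∈ l, IsConj φ) (h : ∀ φ ∈ l, Entails v θ (imp α φ)) :
    Entails v θ (imp α (bigAnd l)) := by
  induction l with
  | nil => exact (to_top hθ).trans (imp_top hα)
  | cons φ l ih =>
    rw [List.forall_mem_cons] at hl h
    exact (h.1.and_intro (ih hl.2 h.2)).trans (imp_and hα hl.1 (.bigAnd hl.2))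

end Entails

/-- The conjunction `⋀ (ψ ⊩ φ)` of the implications of a finite family of pairs `(ψ, φ)`. -/
def bigImp (I : List (Form [] σ × Form [] τ)) : Form [] (.arr σ τ) :=
  bigAnd (I.map fun p => imp p.1 p.2)

variable {I J : List (Form [] σ × Form [] τ)}

theorem isConj_of_mem_map_imp (hI : ∀ p ∈ I, IsConj p.1 ∧ IsConj p.2) :
    ∀ φ ∈ I.map fun p => (imp p.1 p.2 : Form [] (.arr σ τ)), IsConj φ :=
  List.forall_mem_map.2 fun p hp => (hI p hp).1.imp (hI p hp).2

theorem IsConj.bigImp (hI : ∀ p ∈ I, IsConj p.1 ∧ IsConj p.2) : IsConj (bigImp I) :=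
  .bigAnd (isConj_of_mem_map_imp hI)

theorem mem_sem_bigImp {f : ScottMap (den σ) (den τ)} :
    f ∈ ⟦bigImp I⟧ᵛ ↔ ∀ p ∈ I, ∀ x ∈ ⟦p.1⟧ᵛ, f.val x ∈ ⟦p.2⟧ᵛ :=
  mem_sem_bigAnd.trans List.forall_mem_map

namespace Entails

theorem bigImp_intro {θ : Form [] (.arr σ τ)} (hθ : IsConj θ)
    (h : ∀ p ∈ I, Entails v θ (imp p.1 p.2)) : Entails v θ (bigImp I) :=
  bigAnd_intro hθ (List.forall_mem_map.2 h)

theorem bigImp_elim (hI : ∀ p ∈ I, IsConj p.1 ∧ IsConj p.2) {p : Form [] σ × Form [] τ}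
    (hp : p ∈ I) : Entails v (bigImp I) (imp p.1 p.2) :=
  bigAnd_elim (isConj_of_mem_map_imp hI) (List.mem_map.2 ⟨p, hp, rfl⟩)

theorem bigImp_of_subset (hI : ∀ p ∈ I, IsConj p.1 ∧ IsConj p.2) (hJ : J ⊆ I) :
    Entails v (bigImp I) (bigImp J) :=
  bigImp_intro (.bigImp hI) fun _ hp => bigImp_elim hI (hJ hp)

theorem bigImp_imp_bigAnd (hI : ∀ p ∈ I, IsConj p.1 ∧ IsConj p.2) :
    Entails v (bigImp I) (imp (bigAnd (I.map Prod.fst)) (bigAnd (I.map Prod.snd))) := by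
  have hfst : ∀ α ∈ I.map Prod.fst, IsConj α := List.forall_mem_map.2 fun p hp => (hI p hp).1
  refine imp_bigAnd (.bigImp hI) (.bigAnd hfst)
    (List.forall_mem_map.2 fun p hp => (hI p hp).2) (List.forall_mem_map.2 fun p hp => ?_)
  exact (bigImp_elim hI hp).trans
    (imp_mono (bigAnd_elim hfst (List.mem_map_of_mem hp)) (refl (hI p hp).2))

end Entails

theorem Equivalent.bigImp_append (h : ∀ p ∈ I ++ J, IsConj p.1 ∧ IsConj p.2) :
    Equivalent v (and (bigImp I) (bigImp J)) (bigImp (I ++ J)) := by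
  obtain ⟨hI, hJ⟩ := List.forall_mem_append.1 h
  have cI := IsConj.bigImp hI
  have cJ := IsConj.bigImp hJ
  refine ⟨.bigImp_intro (cI.and cJ) (List.forall_mem_append.2 ⟨fun p hp => ?_, fun p hp => ?_⟩),
    .and_intro (.bigImp_of_subset h (List.subset_append_left I J))
      (.bigImp_of_subset h (List.subset_append_right I J))⟩
  · exact (Entails.and_left cI cJ).trans (.bigImp_elim hI hp)
  · exact (Entails.and_right cI cJ).trans (.bigImp_elim hJ hp)

theorem Equivalent.bigImp_singleton (hα : IsConj α) (hφ : IsConj φ) :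
    Equivalent v (imp α φ) (bigImp [(α, φ)]) := (Equivalent.and_top (hα.imp hφ)).symm

/-! ### Normal forms -/

/-- The nesting depth of modalities and implications in a formula, on which the completeness proof
proceeds by induction. -/
def Form.depth : {E : List Ty} → {τ : Ty} → Form E τ → ℕ
  | _, _, .top => 0
  | _, _, .bot => 0
  | _, _, .and φ ψ => max φ.depth ψ.depth
  | _, _, .or φ ψ => max φ.depth ψ.depth
  | _, _, .star => 0
  | _, _, .modal _ φ => φ.depth + 1
  | _, _, .fvar _ => 0
  | _, _, .finmu _ φ => φ.depth
  | _, _, .finnu _ φ => φ.depth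
  | _, _, .ex φ => φ.depth
  | _, _, .all φ => φ.depth
  | _, _, .imp ψ φ => max ψ.depth φ.depth + 1

/-- The conjunctive formulae of depth less than `n`. -/
structure IsConjBelow (n : ℕ) (φ : Form [] τ) : Prop where
  isConj : IsConj φ
  depth_lt : φ.depth < n

variable {n : ℕ}

namespace IsConjBelow

theorem top (hn : 0 < n) : IsConjBelow n (top : Form [] τ) := ⟨.top, hn⟩

theorem and (hφ : IsConjBelow n φ) (hψ : IsConjBelow n ψ) : IsConjBelow n (and φ ψ) :=
  ⟨hφ.isConj.and hψ.isConj, max_lt hφ.depth_lt hψ.depth_lt⟩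

theorem bigAnd (hn : 0 < n) {l : List (Form [] τ)} (h : ∀ φ ∈ l, IsConjBelow n φ) :
    IsConjBelow n (bigAnd l) := by
  induction l with
  | nil => exact top hn
  | cons φ l ih =>
    rw [List.forall_mem_cons] at h
    exact h.1.and (ih h.2)

theorem succ_induction {P : {τ : Ty} → Form [] τ → Prop} (top : ∀ {τ : Ty}, P (.top : Form [] τ))
    (bot : ∀ {τ : Ty}, P (.bot : Form [] τ))
    (and : ∀ {τ : Ty} {φ ψ : Form [] τ}, IsConjBelow (n + 1) φ → IsConjBelow (n + 1) ψ →
      P φ → P ψ → P (.and φ ψ))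
    (star : P .star)
    (modal : ∀ {σ τ : Ty} (m : Modality σ τ) {α : Form [] σ}, IsConjBelow n α → P (.modal m α))
    (imp : ∀ {σ τ : Ty} {α : Form [] σ} {β : Form [] τ}, IsConjBelow n α → IsConjBelow n β →
      P (.imp α β))
    (h : IsConjBelow (n + 1) φ) : P φ := by
  obtain ⟨hφ, hd⟩ := h
  induction hφ with
  | top => exact top
  | bot => exact bot
  | and h₁ h₂ ih₁ ih₂ =>
    obtain ⟨hd₁, hd₂⟩ := max_lt_iff.1 hd
    exact and ⟨h₁, hd₁⟩ ⟨h₂, hd₂⟩ (ih₁ hd₁) (ih₂ hd₂)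
  | star => exact star
  | modal h => exact modal _ ⟨h, Nat.lt_of_succ_lt_succ hd⟩
  | imp h₁ h₂ =>
    obtain ⟨hd₁, hd₂⟩ := max_lt_iff.1 (Nat.lt_of_succ_lt_succ hd)
    exact imp ⟨h₁, hd₁⟩ ⟨h₂, hd₂⟩

end IsConjBelow

/-- The normal forms of the conjunctive formulae of depth at most `n`: apart from `⊤` and `⊥`, the
shape of a normal form is determined by its type. -/
inductive IsNormal (n : ℕ) : {τ : Ty} → Form [] τ → Prop
  | top {τ : Ty} : IsNormal n (top : Form [] τ)
  | bot {τ : Ty} : IsNormal n (bot : Form [] τ)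
  | star : IsNormal n star
  | pair {σ τ : Ty} {α : Form [] σ} {β : Form [] τ} (hα : IsConjBelow n α)
      (hβ : IsConjBelow n β) : IsNormal n (and (modal .pi1 α) (modal .pi2 β))
  | in1 {σ τ : Ty} {α : Form [] σ} (hα : IsConjBelow n α) :
      IsNormal n (modal (.in1 : Modality σ (.sum σ τ)) α)
  | in2 {σ τ : Ty} {β : Form [] τ} (hβ : IsConjBelow n β) :
      IsNormal n (modal (.in2 : Modality τ (.sum σ τ)) β)
  | fold {τ : TyExpr 1} {α : Form [] τ.unfolding} (hα : IsConjBelow n α) :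
      IsNormal n (modal .fold α)
  | bigImp {σ τ : Ty} {I : List (Form [] σ × Form [] τ)} (hn : 0 < n)
      (hI : ∀ p ∈ I, IsConjBelow n p.1 ∧ IsConjBelow n p.2) : IsNormal n (bigImp I)

theorem isConj_of_isConjBelow (hI : ∀ p ∈ I, IsConjBelow n p.1 ∧ IsConjBelow n p.2) :
    ∀ p ∈ I, IsConj p.1 ∧ IsConj p.2 :=
  fun p hp => ⟨(hI p hp).1.isConj, (hI p hp).2.isConj⟩

theorem IsNormal.isConj (h : IsNormal n φ) : IsConj φ := by
  cases h with
  | top => exact .top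
  | bot => exact .bot
  | star => exact .star
  | pair hα hβ => exact hα.isConj.modal.and hβ.isConj.modal
  | in1 hα => exact hα.isConj.modal
  | in2 hβ => exact hβ.isConj.modal
  | fold hα => exact hα.isConj.modal
  | bigImp _ hI => exact .bigImp (isConj_of_isConjBelow hI)

/-- The formula is equivalent to a normal form. -/
def HasNormalForm (v : ℕ → ℕ) (n : ℕ) (φ : Form [] τ) : Prop :=
  ∃ φ', IsNormal n φ' ∧ Equivalent v φ φ'

namespace HasNormalForm

theorem congr (h : Equivalent v φ ψ) : HasNormalForm v n ψ → HasNormalForm v n φ :=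
  fun ⟨χ, hχ, h'⟩ => ⟨χ, hχ, h.trans h'⟩

theorem of_isNormal (h : IsNormal n φ) : HasNormalForm v n φ := ⟨φ, h, .refl h.isConj⟩

theorem and_of_isNormal {τ : Ty} {φ ψ : Form [] τ} :
    IsNormal n φ → IsNormal n ψ → HasNormalForm v n (and φ ψ)
  | hφ, .top => congr (.and_top hφ.isConj) (of_isNormal hφ)
  | hφ, .bot => congr (.and_bot hφ.isConj) (of_isNormal .bot)
  | .top, hψ =>
    congr ((Equivalent.and_comm .top hψ.isConj).trans (.and_top hψ.isConj)) (of_isNormal hψ)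
  | .bot, hψ =>
    congr ((Equivalent.and_comm .bot hψ.isConj).trans (.and_bot hψ.isConj)) (of_isNormal .bot)
  | .star, .star => congr (.and_self .star) (of_isNormal .star)
  | .pair hα hβ, .pair hα' hβ' =>
    ⟨_, .pair (hα.and hα') (hβ.and hβ'),
      (Equivalent.and_and_and_comm hα.isConj.modal hβ.isConj.modal hα'.isConj.modal
        hβ'.isConj.modal).trans (.and_congr (.modal_and _ hα.isConj hα'.isConj)
          (.modal_and _ hβ.isConj hβ'.isConj))⟩
  | .in1 hα, .in1 hα' => ⟨_, .in1 (hα.and hα'), .modal_and _ hα.isConj hα'.isConj⟩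
  | .in1 hα, .in2 hβ => ⟨bot, .bot, .in1_and_in2 hα.isConj hβ.isConj⟩
  | .in2 hβ, .in1 hα =>
    ⟨bot, .bot, (Equivalent.and_comm hβ.isConj.modal hα.isConj.modal).trans
      (.in1_and_in2 hα.isConj hβ.isConj)⟩
  | .in2 hβ, .in2 hβ' => ⟨_, .in2 (hβ.and hβ'), .modal_and _ hβ.isConj hβ'.isConj⟩
  | .fold hα, .fold hα' => ⟨_, .fold (hα.and hα'), .modal_and _ hα.isConj hα'.isConj⟩
  | .bigImp hn hI, .bigImp _ hJ =>
    have hIJ := List.forall_mem_append.2 ⟨hI, hJ⟩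
    ⟨_, .bigImp hn hIJ, .bigImp_append (isConj_of_isConjBelow hIJ)⟩

theorem and : HasNormalForm v n φ → HasNormalForm v n ψ → HasNormalForm v n (and φ ψ) :=
  fun ⟨_, hφ', hφ⟩ ⟨_, hψ', hψ⟩ => congr (.and_congr hφ hψ) (and_of_isNormal hφ' hψ')

theorem modal (m : Modality σ τ) (hα : IsConjBelow n α) : HasNormalForm v n (modal m α) := by
  have htop {ρ : Ty} : IsConjBelow n (.top : Form [] ρ) := .top (Nat.zero_lt_of_lt hα.depth_lt)
  have cα := hα.isConj.modal (m := m)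
  cases m with
  | pi1 => exact ⟨_, .pair hα htop,
      (Equivalent.and_top cα).symm.trans (.and_congr (.refl cα) (.modal_top .pi2 id))⟩
  | pi2 => exact ⟨_, .pair htop hα,
      ((Equivalent.and_top cα).symm.trans (.and_comm cα .top)).trans
        (.and_congr (.modal_top .pi1 id) (.refl cα))⟩
  | in1 => exact of_isNormal (.in1 hα)
  | in2 => exact of_isNormal (.in2 hα)
  | fold => exact of_isNormal (.fold hα)

theorem imp (hα : IsConjBelow n α) (hφ : IsConjBelow n φ) : HasNormalForm v n (imp α φ) :=
  ⟨_, .bigImp (Nat.zero_lt_of_lt hα.depth_lt) (List.forall_mem_singleton.2 ⟨hα, hφ⟩),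
    .bigImp_singleton hα.isConj hφ.isConj⟩

end HasNormalForm

theorem IsConjBelow.hasNormalForm (h : IsConjBelow (n + 1) φ) : HasNormalForm v n φ :=
  h.succ_induction (P := fun φ => HasNormalForm v n φ) (.of_isNormal .top) (.of_isNormal .bot)
    (fun _ _ => .and) (.of_isNormal .star) (fun m _ hα => .modal m hα) .imp

/-! ### Families of implications -/

variable (v) in
open Classical in
/-- The members of the family `I` whose premise holds at `x`. -/
def active (I : List (Form [] σ × Form [] τ)) (x : den σ) : List (Form [] σ × Form [] τ) :=
  I.filter fun p => x ∈ ⟦p.1⟧ᵛ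

variable (v) in
/-- The conjunction of the premises in `I` that hold at `x`. -/
def activePremise (I : List (Form [] σ × Form [] τ)) (x : den σ) : Form [] σ :=
  bigAnd ((active v I x).map Prod.fst)

variable (v) in
/-- The conjunction of the conclusions in `I` that every realizer of `bigImp I` satisfies at `x`. -/
def activeConclusion (I : List (Form [] σ × Form [] τ)) (x : den σ) : Form [] τ :=
  bigAnd ((active v I x).map Prod.snd)

variable {x : den σ}

theorem mem_active {p : Form [] σ × Form [] τ} : p ∈ active v I x ↔ p ∈ I ∧ x ∈ ⟦p.1⟧ᵛ := by
  simp only [active, List.mem_filter, decide_eq_true_eq]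

theorem active_subset : active v I x ⊆ I := fun _ hp => (mem_active.1 hp).1

theorem mem_sem_activePremise {y : den σ} :
    y ∈ ⟦activePremise v I x⟧ᵛ ↔ ∀ p ∈ I, x ∈ ⟦p.1⟧ᵛ → y ∈ ⟦p.1⟧ᵛ := by
  simp only [activePremise, mem_sem_bigAnd, List.forall_mem_map, mem_active, and_imp]

theorem mem_sem_activeConclusion {y : den τ} :
    y ∈ ⟦activeConclusion v I x⟧ᵛ ↔ ∀ p ∈ I, x ∈ ⟦p.1⟧ᵛ → y ∈ ⟦p.2⟧ᵛ := by
  simp only [activeConclusion, mem_sem_bigAnd, List.forall_mem_map, mem_active, and_imp]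

theorem mem_sem_activePremise_self : x ∈ ⟦activePremise v I x⟧ᵛ :=
  mem_sem_activePremise.2 fun _ _ => id

theorem apply_mem_sem_activeConclusion {f : ScottMap (den σ) (den τ)} (hf : f ∈ ⟦bigImp I⟧ᵛ)
    (x : den σ) : f.val x ∈ ⟦activeConclusion v I x⟧ᵛ :=
  mem_sem_activeConclusion.2 fun p hp => mem_sem_bigImp.1 hf p hp x

theorem IsConjBelow.activePremise (hn : 0 < n)
    (hI : ∀ p ∈ I, IsConjBelow n p.1 ∧ IsConjBelow n p.2) (x : den σ) :
    IsConjBelow n (activePremise v I x) :=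
  .bigAnd hn (List.forall_mem_map.2 fun p hp => (hI p (active_subset hp)).1)

theorem IsConjBelow.activeConclusion (hn : 0 < n)
    (hI : ∀ p ∈ I, IsConjBelow n p.1 ∧ IsConjBelow n p.2) (x : den σ) :
    IsConjBelow n (activeConclusion v I x) :=
  .bigAnd hn (List.forall_mem_map.2 fun p hp => (hI p (active_subset hp)).2)

theorem Entails.bigImp_active (hI : ∀ p ∈ I, IsConj p.1 ∧ IsConj p.2) (x : den σ) :
    Entails v (bigImp I) (imp (activePremise v I x) (activeConclusion v I x)) :=
  (bigImp_of_subset hI active_subset).trans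
    (bigImp_imp_bigAnd fun p hp => hI p (active_subset hp))

/-! ### Induction on the depth -/

variable (v n) in
/-- Completeness for the conjunctive formulae of depth less than `n`, together with the two
semantic facts that the induction needs: such formulae denote Scott-open sets, which have a least
element unless they are empty. -/
structure CompleteAt : Prop where
  isScottOpen {τ : Ty} {φ : Form [] τ} : IsConjBelow n φ → IsScottOpen ⟦φ⟧ᵛ
  exists_isLeast {τ : Ty} {φ : Form [] τ} :
    IsConjBelow n φ → ⟦φ⟧ᵛ.Nonempty → ∃ x, IsLeast ⟦φ⟧ᵛ x
  cons {τ : Ty} {φ : Form [] τ} : IsConjBelow n φ → ⟦φ⟧ᵛ.Nonempty → Cons φ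
  entails {τ : Ty} {ψ φ : Form [] τ} :
    IsConjBelow n ψ → IsConjBelow n φ → ⟦ψ⟧ᵛ ⊆ ⟦φ⟧ᵛ → Entails v ψ φ

namespace CompleteAt

theorem entails_bot (H : CompleteAt v n) (hφ : IsConjBelow n φ) (h : ⟦φ⟧ᵛ = ∅) :
    Entails v φ bot :=
  H.entails hφ ⟨.bot, Nat.zero_lt_of_lt hφ.depth_lt⟩ h.le

theorem modal_entails_bot (H : CompleteAt v n) {m : Modality σ τ} (hα : IsConjBelow n α)
    (h : ⟦α⟧ᵛ = ∅) : Entails v (modal m α) bot :=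
  (Entails.modal_mono m (H.entails_bot hα h)).trans (.modal_bot m)

theorem modal_entails_modal (H : CompleteAt v n) {m : Modality σ τ} {β : Form [] σ}
    (hα : IsConjBelow n α) (hβ : IsConjBelow n β) (h : ⟦modal m α⟧ᵛ ⊆ ⟦modal m β⟧ᵛ) :
    Entails v (modal m α) (modal m β) :=
  .modal_mono m (H.entails hα hβ (m.sem_subset_sem_iff.1 h))

theorem top_entails_modal (H : CompleteAt v n) {m : Modality σ τ} (hα : IsConjBelow n α)
    (h : ⟦modal m α⟧ᵛ = Set.univ) : Entails v top (modal m α) := by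
  have hm : m.sem Set.univ = Set.univ :=
    Set.univ_subset_iff.1 (h.ge.trans (m.sem_subset_sem_iff.2 (Set.subset_univ _)))
  refine (Entails.modal_top m (m.sem_univ_eq_univ_iff.1 hm)).trans
    (H.modal_entails_modal (.top (Nat.zero_lt_of_lt hα.depth_lt)) hα ?_)
  exact (Set.subset_univ _).trans h.ge

/-- The step function: its value at `x` is the least element satisfying the conclusions that are
active at `x`. -/
theorem exists_isLeast_bigImp (H : CompleteAt v n) (hn : 0 < n)
    (hI : ∀ p ∈ I, IsConjBelow n p.1 ∧ IsConjBelow n p.2)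
    (hne : ∀ x, ⟦activeConclusion v I x⟧ᵛ.Nonempty) :
    ∃ f : ScottMap (den σ) (den τ), IsLeast ⟦bigImp I⟧ᵛ f ∧
      ∀ x, IsLeast ⟦activeConclusion v I x⟧ᵛ (f.val x) := by
  choose u hu using fun x => H.exists_isLeast (.activeConclusion hn hI x) (hne x)
  have hcont : ScottContinuous u := scottContinuous_of_isScottOpen_nhds fun x =>
    ⟨⟦activePremise v I x⟧ᵛ, H.isScottOpen (.activePremise hn hI x), mem_sem_activePremise_self,
      fun y hy => (hu x).2 <| mem_sem_activeConclusion.2 fun p hp hx =>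
        mem_sem_activeConclusion.1 (hu y).1 p hp (mem_sem_activePremise.1 hy p hp hx)⟩
  refine ⟨⟨u, hcont⟩, ⟨mem_sem_bigImp.2 fun p hp x hx => ?_, fun g hg x => ?_⟩, hu⟩
  · exact mem_sem_activeConclusion.1 (hu x).1 p hp hx
  · exact (hu x).2 (apply_mem_sem_activeConclusion hg x)

theorem bigImp_entails_bot (H : CompleteAt v n) (hn : 0 < n)
    (hI : ∀ p ∈ I, IsConjBelow n p.1 ∧ IsConjBelow n p.2) (h : ⟦bigImp I⟧ᵛ = ∅) :
    Entails v (bigImp I) bot := by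
  obtain ⟨x, hx⟩ : ∃ x, ⟦activeConclusion v I x⟧ᵛ = ∅ := by
    by_contra! hne
    obtain ⟨f, hf, -⟩ := H.exists_isLeast_bigImp hn hI hne
    exact h.le hf.1
  have hprem : IsConjBelow n (activePremise v I x) := .activePremise hn hI x
  have hprem_ne : ⟦activePremise v I x⟧ᵛ.Nonempty := ⟨x, mem_sem_activePremise_self⟩
  exact ((Entails.bigImp_active (isConj_of_isConjBelow hI) x).trans
    (.imp_mono (.refl hprem.isConj) (H.entails_bot (.activeConclusion hn hI x) hx))).trans
      (.imp_bot hprem.isConj (H.cons hprem hprem_ne) hprem_ne)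

theorem cons_bigImp_of_forall_nonempty (H : CompleteAt v n) (hn : 0 < n)
    (hI : ∀ p ∈ I, IsConjBelow n p.1 ∧ IsConjBelow n p.2)
    (hne : ∀ p ∈ I, ⟦p.1⟧ᵛ.Nonempty) (h : ⟦bigImp I⟧ᵛ.Nonempty) : Cons (bigImp I) := by
  obtain ⟨f, hf⟩ := h
  replace hf := mem_sem_bigImp.1 hf
  refine .imp I (fun p hp => H.cons (hI p hp).1 (hne p hp)) (fun p hp => ?_) fun J hJ => ?_
  · obtain ⟨a, ha⟩ := hne p hp
    exact H.cons (hI p hp).2 ⟨f.val a, hf p hp a ha⟩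
  have hfst : IsConjBelow n (bigAnd (J.map Prod.fst)) :=
    .bigAnd hn (List.forall_mem_map.2 fun p hp => (hI p (hJ.subset hp)).1)
  have hsnd : IsConjBelow n (bigAnd (J.map Prod.snd)) :=
    .bigAnd hn (List.forall_mem_map.2 fun p hp => (hI p (hJ.subset hp)).2)
  obtain hJ_empty | ⟨a, ha⟩ := ⟦bigAnd (J.map Prod.fst)⟧ᵛ.eq_empty_or_nonempty
  · exact .incons (H.entails_bot hfst hJ_empty).ded
  · rw [mem_sem_bigAnd, List.forall_mem_map] at ha
    exact .cons (H.cons hsnd ⟨f.val a, mem_sem_bigAnd.2 (List.forall_mem_map.2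
      fun p hp => hf p (hJ.subset hp) a (ha p hp))⟩)

theorem top_entails_imp (H : CompleteAt v n) (hα : IsConjBelow n α) (h : ⟦α⟧ᵛ = ∅)
    (hφ : IsConj φ) : Entails v top (imp α φ) :=
  (Entails.bot_imp σ hφ).trans (.imp_mono (H.entails_bot hα h) (.refl hφ))

/-- The consistency rule for implications requires consistent premises; an implication with an
inconsistent premise is derivable, hence can be dropped first. -/
theorem cons_bigImp (H : CompleteAt v n) (hn : 0 < n)
    (hI : ∀ p ∈ I, IsConjBelow n p.1 ∧ IsConjBelow n p.2) (h : ⟦bigImp I⟧ᵛ.Nonempty) :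
    Cons (bigImp I) := by
  classical
  have hI' := isConj_of_isConjBelow hI
  set K := I.filter fun p => ⟦p.1⟧ᵛ.Nonempty with hK
  have mem_K {p} : p ∈ K ↔ p ∈ I ∧ ⟦p.1⟧ᵛ.Nonempty := by
    simp only [hK, List.mem_filter, decide_eq_true_eq]
  have hKI : K ⊆ I := fun p hp => (mem_K.1 hp).1
  have hK' : ∀ p ∈ K, IsConj p.1 ∧ IsConj p.2 := fun p hp => hI' p (hKI hp)
  have hcons : Cons (bigImp K) := H.cons_bigImp_of_forall_nonempty hn
    (fun p hp => hI p (hKI hp)) (fun p hp => (mem_K.1 hp).2)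
    (h.mono (Entails.bigImp_of_subset hI' hKI).subset)
  have hKI_entails : Entails v (bigImp K) (bigImp I) := .bigImp_intro (.bigImp hK') fun p hp => by
    obtain hp_empty | hp_ne := ⟦p.1⟧ᵛ.eq_empty_or_nonempty
    · exact (Entails.to_top (.bigImp hK')).trans
        (H.top_entails_imp (hI p hp).1 hp_empty (hI' p hp).2)
    · exact .bigImp_elim hK' (mem_K.2 ⟨hp, hp_ne⟩)
  exact .ded hcons hKI_entails.ded (.bigImp hI')

theorem bigImp_entails_imp (H : CompleteAt v n) (hn : 0 < n)
    (hI : ∀ p ∈ I, IsConjBelow n p.1 ∧ IsConjBelow n p.2) (hne : ⟦bigImp I⟧ᵛ.Nonempty)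
    (hα : IsConjBelow n α) (hφ : IsConjBelow n φ) (h : ⟦bigImp I⟧ᵛ ⊆ ⟦imp α φ⟧ᵛ) :
    Entails v (bigImp I) (imp α φ) := by
  have hI' := isConj_of_isConjBelow hI
  obtain hα_empty | hα_ne := ⟦α⟧ᵛ.eq_empty_or_nonempty
  · exact (Entails.to_top (.bigImp hI')).trans (H.top_entails_imp hα hα_empty hφ.isConj)
  obtain ⟨g, hg⟩ := hne
  obtain ⟨f, hf, hf_least⟩ := H.exists_isLeast_bigImp hn hI
    fun x => ⟨g.val x, apply_mem_sem_activeConclusion hg x⟩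
  obtain ⟨a, ha⟩ := H.exists_isLeast hα hα_ne
  have hprem : Entails v α (activePremise v I a) :=
    H.entails hα (.activePremise hn hI a) fun x hx => mem_sem_activePremise.2
      fun p hp => (H.isScottOpen (hI p hp).1).isUpperSet (ha.2 hx)
  have hconcl : Entails v (activeConclusion v I a) φ :=
    H.entails (.activeConclusion hn hI a) hφ fun y hy =>
      (H.isScottOpen hφ).isUpperSet ((hf_least a).2 hy) (h hf.1 a ha.1)
  exact (Entails.bigImp_active hI' a).trans (.imp_mono hprem hconcl)

end CompleteAt

theorem IsConjBelow.isScottOpen_succ (H : CompleteAt v n) (h : IsConjBelow (n + 1) φ) :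
    IsScottOpen ⟦φ⟧ᵛ := by
  refine h.succ_induction (P := fun φ => IsScottOpen ⟦φ⟧ᵛ)
    .univ .empty (fun _ _ => .inter) isScottOpen_singleton_true
    (fun m _ hα => m.isScottOpen_sem (H.isScottOpen hα)) fun {_ τ α β} hα hβ => ?_
  obtain hα_empty | hα_ne := ⟦α⟧ᵛ.eq_empty_or_nonempty
  · convert IsScottOpen.univ using 1
    exact Set.eq_univ_of_forall fun f x hx => (hα_empty.le hx).elim
  · obtain ⟨a, ha⟩ := H.exists_isLeast hα hα_ne
    exact (H.isScottOpen hβ).setOf_forall_mem (isDirectedComplete_den τ) ha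

namespace IsNormal

theorem entails_bot (H : CompleteAt v n) (hφ : IsNormal n φ) (h : ⟦φ⟧ᵛ = ∅) :
    Entails v φ .bot := by
  cases hφ with
  | top => exact absurd h Set.univ_nonempty.ne_empty
  | bot => exact .refl .bot
  | star => exact absurd h (Set.singleton_ne_empty true)
  | pair hα hβ =>
    rcases Set.prod_eq_empty_iff.1 h with h | h
    · exact (Entails.and_left hα.isConj.modal hβ.isConj.modal).trans (H.modal_entails_bot hα h)
    · exact (Entails.and_right hα.isConj.modal hβ.isConj.modal).trans (H.modal_entails_bot hβ h)
  | in1 hα => exact H.modal_entails_bot hα ((Modality.sem_eq_empty_iff _).1 h)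
  | in2 hβ => exact H.modal_entails_bot hβ ((Modality.sem_eq_empty_iff _).1 h)
  | fold hα => exact H.modal_entails_bot hα ((Modality.sem_eq_empty_iff _).1 h)
  | bigImp hn hI => exact H.bigImp_entails_bot hn hI h

theorem cons (H : CompleteAt v n) (hφ : IsNormal n φ) (h : ⟦φ⟧ᵛ.Nonempty) : Cons φ := by
  cases hφ with
  | top => exact .top
  | bot => exact absurd h Set.not_nonempty_empty
  | star => exact .star
  | pair hα hβ =>
    obtain ⟨h₁, h₂⟩ := Set.prod_nonempty_iff.1 h
    exact .pair (H.cons hα h₁) (H.cons hβ h₂)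
  | in1 hα => exact .in1 (H.cons hα ((Modality.sem_nonempty_iff _).1 h))
  | in2 hβ => exact .in2 (H.cons hβ ((Modality.sem_nonempty_iff _).1 h))
  | fold hα => exact .fold (H.cons hα ((Modality.sem_nonempty_iff _).1 h))
  | bigImp hn hI => exact H.cons_bigImp hn hI h

theorem exists_isLeast (H : CompleteAt v n) (hφ : IsNormal n φ) (h : ⟦φ⟧ᵛ.Nonempty) :
    ∃ x, IsLeast ⟦φ⟧ᵛ x := by
  cases hφ with
  | top =>
    obtain ⟨x, hx⟩ := exists_isBot_den τ
    exact ⟨x, trivial, fun y _ => hx y⟩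
  | bot => exact absurd h Set.not_nonempty_empty
  | star => exact ⟨true, isLeast_singleton⟩
  | pair hα hβ =>
    obtain ⟨h₁, h₂⟩ := Set.prod_nonempty_iff.1 h
    obtain ⟨a, ha⟩ := H.exists_isLeast hα h₁
    obtain ⟨b, hb⟩ := H.exists_isLeast hβ h₂
    exact ⟨(a, b), ⟨ha.1, hb.1⟩, fun y hy => ⟨ha.2 hy.1, hb.2 hy.2⟩⟩
  | in1 hα =>
    obtain ⟨a, ha⟩ := H.exists_isLeast hα ((Modality.sem_nonempty_iff _).1 h)
    exact ⟨_, (WithBot.coe_mono.comp Sum.inl_mono).map_isLeast ha⟩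
  | in2 hβ =>
    obtain ⟨b, hb⟩ := H.exists_isLeast hβ ((Modality.sem_nonempty_iff _).1 h)
    exact ⟨_, (WithBot.coe_mono.comp Sum.inr_mono).map_isLeast hb⟩
  | @fold τ _ hα =>
    obtain ⟨a, ha⟩ := H.exists_isLeast hα ((Modality.sem_nonempty_iff _).1 h)
    have h := (unfold τ).symm.monotone.map_isLeast ha
    rw [OrderIso.image_eq_preimage_symm] at h
    exact ⟨_, h⟩
  | bigImp hn hI =>
    obtain ⟨g, hg⟩ := h
    obtain ⟨f, hf, -⟩ := H.exists_isLeast_bigImp hn hI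
      fun x => ⟨g.val x, apply_mem_sem_activeConclusion hg x⟩
    exact ⟨f, hf⟩

theorem entails_modal (H : CompleteAt v n) (hψ : IsNormal n ψ) (hne : ⟦ψ⟧ᵛ.Nonempty)
    {m : Modality σ τ} (hα : IsConjBelow n α) (h : ⟦ψ⟧ᵛ ⊆ ⟦modal m α⟧ᵛ) :
    Entails v ψ (modal m α) := by
  cases hψ with
  | top => exact H.top_entails_modal hα (Set.univ_subset_iff.1 h)
  | bot => exact absurd hne Set.not_nonempty_empty
  | star => cases m
  | pair hα' hβ' =>
    obtain ⟨⟨a, b⟩, ha, hb⟩ := hne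
    cases m with
    | pi1 =>
      exact (Entails.and_left hα'.isConj.modal hβ'.isConj.modal).trans
        (.modal_mono _ (H.entails hα' hα fun x hx => @h (x, b) ⟨hx, hb⟩))
    | pi2 =>
      exact (Entails.and_right hα'.isConj.modal hβ'.isConj.modal).trans
        (.modal_mono _ (H.entails hβ' hα fun y hy => @h (a, y) ⟨ha, hy⟩))
  | in1 hα' =>
    cases m with
    | in1 => exact H.modal_entails_modal hα' hα h
    | in2 =>
      obtain ⟨x, hx⟩ := hne
      exact ((Modality.disjoint_sem_in1_sem_in2 _ _).ne_of_mem hx (h hx) rfl).elim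
  | in2 hβ' =>
    cases m with
    | in1 =>
      obtain ⟨x, hx⟩ := hne
      exact ((Modality.disjoint_sem_in1_sem_in2 _ _).ne_of_mem (h hx) hx rfl).elim
    | in2 => exact H.modal_entails_modal hβ' hα h
  | fold hα' =>
    cases m with
    | fold => exact H.modal_entails_modal hα' hα h
  | bigImp _ _ => cases m

theorem entails_imp (H : CompleteAt v n) {ψ : Form [] (.arr σ τ)} (hψ : IsNormal n ψ)
    (hne : ⟦ψ⟧ᵛ.Nonempty) (hα : IsConjBelow n α) (hφ : IsConjBelow n φ)
    (h : ⟦ψ⟧ᵛ ⊆ ⟦imp α φ⟧ᵛ) : Entails v ψ (imp α φ) := by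
  cases hψ with
  | top =>
    exact H.bigImp_entails_imp (I := []) (Nat.zero_lt_of_lt hα.depth_lt) (List.forall_mem_nil _)
      hne hα hφ h
  | bot => exact absurd hne Set.not_nonempty_empty
  | bigImp hn hI => exact H.bigImp_entails_imp hn hI hne hα hφ h

theorem entails_star {ψ : Form [] .unit} (hψ : IsNormal n ψ) (h : ⟦ψ⟧ᵛ ⊆ ⟦Form.star⟧ᵛ) :
    Entails v ψ .star := by
  cases hψ with
  | top => exact absurd (@h false trivial) Bool.false_ne_true
  | bot => exact .of_bot .star
  | star => exact .refl .star

theorem entails_of_nonempty (H : CompleteAt v n) (hψ : IsNormal n ψ) (hne : ⟦ψ⟧ᵛ.Nonempty)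
    (hφ : IsConjBelow (n + 1) φ) (h : ⟦ψ⟧ᵛ ⊆ ⟦φ⟧ᵛ) : Entails v ψ φ :=
  hφ.succ_induction
    (P := fun {τ} φ => ∀ ψ : Form [] τ, IsNormal n ψ → ⟦ψ⟧ᵛ.Nonempty → ⟦ψ⟧ᵛ ⊆ ⟦φ⟧ᵛ → Entails v ψ φ)
    (fun _ hψ _ _ => .to_top hψ.isConj)
    (fun _ hψ _ h => hψ.entails_bot H (Set.subset_empty_iff.1 h))
    (fun _ _ ih₁ ih₂ ψ hψ hne h => (ih₁ ψ hψ hne (h.trans Set.inter_subset_left)).and_intro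
      (ih₂ ψ hψ hne (h.trans Set.inter_subset_right)))
    (fun _ hψ _ h => hψ.entails_star h)
    (fun _ _ hα _ hψ hne h => hψ.entails_modal H hne hα h)
    (fun hα hβ _ hψ hne h => hψ.entails_imp H hne hα hβ h) ψ hψ hne h

end IsNormal

theorem CompleteAt.succ (H : CompleteAt v n) : CompleteAt v (n + 1) where
  isScottOpen h := h.isScottOpen_succ H
  exists_isLeast h hne := by
    obtain ⟨φ', hφ', heq⟩ := h.hasNormalForm (v := v)
    rw [heq.sem_eq] at hne ⊢
    exact hφ'.exists_isLeast H hne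
  cons h hne := by
    obtain ⟨φ', hφ', heq⟩ := h.hasNormalForm (v := v)
    exact .ded (hφ'.cons H (hne.mono heq.mp.subset)) heq.mpr.ded h.isConj
  entails {_ ψ φ} hψ hφ hsub := by
    obtain ⟨ψ', hψ', heq⟩ := hψ.hasNormalForm (v := v)
    refine heq.mp.trans ?_
    obtain hψ'_empty | hψ'_ne := ⟦ψ'⟧ᵛ.eq_empty_or_nonempty
    · exact (hψ'.entails_bot H hψ'_empty).trans (.of_bot hφ.isConj)
    · exact hψ'.entails_of_nonempty H hψ'_ne hφ (heq.mpr.subset.trans hsub)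

variable (v n) in
theorem completeAt : CompleteAt v n := by
  induction n with
  | zero =>
    have none_below {τ : Ty} {φ : Form [] τ} : ¬ IsConjBelow 0 φ :=
      fun h => Nat.not_lt_zero _ h.depth_lt
    exact ⟨(absurd · none_below), (absurd · none_below), (absurd · none_below),
      (absurd · none_below)⟩
  | succ n ih => exact ih.succ

end

end PosLog

end

theorem mainTheorem5 (τ : PosLog.Ty) (φ ψ : PosLog.Form [] τ)
    (hφ : PosLog.IsConj φ) (hψ : PosLog.IsConj ψ) (v : ℕ → ℕ) :
    ((φ.sem PosLog.Val.nil v).Nonempty → PosLog.Cons φ) ∧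
      (ψ.sem PosLog.Val.nil v ⊆ φ.sem PosLog.Val.nil v → PosLog.Ded ψ φ) := by
  have H := PosLog.completeAt v (max φ.depth ψ.depth + 1)
  have hφ' : PosLog.IsConjBelow (max φ.depth ψ.depth + 1) φ :=
    ⟨hφ, Nat.lt_succ_of_le (le_max_left _ _)⟩
  have hψ' : PosLog.IsConjBelow (max φ.depth ψ.depth + 1) ψ :=
    ⟨hψ, Nat.lt_succ_of_le (le_max_right _ _)⟩
  exact ⟨H.cons hφ', fun h => (H.entails hψ' hφ' h).ded⟩
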